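/- Let $\lambda$ be a partition with largest part $L=\lambda_1$, conjugate $\lambda'$ and $\ell(\lambda)$ parts, and let $n\ge \ell(\lambda)$. A multiline queue of shape $\lambda$ on $n$ columns is a tuple $M=(B_1,\dots,B_L)$ of subsets of $\{1,\dots,n\}$ with $|B_r|=\lambda'_r$; $B_r$ is the set of columns with a ball in row $r$, rows being numbered from bottom to top. Type. The Ferrari–Martin algorithm labels the balls of $M$. For $r=L,\dots,2$: every unlabelled ball in row $r$ gets the label $r$; then the balls of row $r$, in order of decreasing label and from left to right among equal labels, are paired one after another to the first unlabelled ball weakly to the right in row $r-1$ (wrapping around from column $n$ to column $1$), which receives the label of the ball paired to it. Finally the unlabelled balls of row $1$ get the label $1$. Then $\mathrm{type}(M)\in\mathbb{Z}_{\ge 0}^n$ is the sequence of labels in row $1$, with $0$ at the empty sites. Collapse. For a tuple of subsets of $\{1,\dots,n\}$ and an index $i$, form a bracket word by scanning the columns from left to right, writing in each column first "(" if there is a ball in row $i+1$ and then ")" if there is a ball in row $i$. Match the brackets in the usual way, and let $e_i^{\downarrow\star}$ move all balls of row $i+1$ whose bracket is unmatched to row $i$, in the same columns. Put $$\rho(M)=\bigl(e_1^{\downarrow\star}e_2^{\downarrow\star}\cdots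 e_{L-1}^{\downarrow\star}\bigr)\cdots\bigl(e_1^{\downarrow\star}e_2^{\downarrow\star}\bigr)\bigl(e_1^{\downarrow\star}\bigr)(M),$$ operators being applied from right to left. The result is again a multiline queue (up to empty rows at the top), and its type is defined in the same way. Theorem. Let $M$ be a multiline queue of shape $\lambda$ on $n$ columns, $\alpha=\mathrm{type}(M)$ and $\beta=\mathrm{type}(\rho(M))$. For all $1\le i<j\le n$, if $\alpha_i<\alpha_j$ then $\beta_i<\beta_j$. Equivalently, with a coinversion of a composition $\gamma$ being a pair $i<j$ with $\gamma_i<\gamma_j$, every coinversion of $\alpha$ is a coinversion of $\beta$. -/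

import Mathlib

namespace MultilineQueue

/-- An array of balls on `n` columns, as the tuple `(B₁, …, B_L)` of its rows from bottom to top:
`B_r` is the set of columns with a ball in row `r`. Column `j` (for `1 ≤ j ≤ n`) is the element
`j - 1` of `Fin n`. This is a generalized multiline queue: the sizes of the rows are arbitrary. -/
abbrev BallArray (n : ℕ) : Type := List (Finset (Fin n))

/-- `M = (B₁, …, B_L)` is a multiline queue of shape `lam`, where the partition `lam` is given by
its Young diagram: the number of rows is the largest part of `lam`, and row `j` contains as many
balls as the `j`-th part of the conjugate partition says. -/
def IsMultilineQueue {n : ℕ} (lam : YoungDiagram) (M : BallArray n) : Prop :=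
  M.length = lam.rowLen 0 ∧ ∀ (j : ℕ) (hj : j < M.length), (M[j]).card = lam.colLen j

/-! ### The Ferrari–Martin algorithm and the type

A labelled row is a function `Fin n → ℕ`, with value `0` at the columns that carry no label. -/

/-- The balls of a labelled row with their labels, in the order in which they are paired to the row
below: from the largest label to the smallest, and from left to right among equal labels. -/
def pairingOrder {n : ℕ} (upper : Fin n → ℕ) : List (Fin n × ℕ) :=
  (List.range (Finset.univ.sup upper)).reverse.flatMap fun k =>
    ((List.finRange n).filter fun c => upper c = k + 1).map fun c => (c, k + 1)

/-- The first column weakly to the right of `c` (that is, in the order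
`c, c + 1, …, n, 1, …, c - 1`) that carries a ball of the row `B` without label so far. -/
def firstUnlabeled {n : ℕ} (B : Finset (Fin n)) (lower : Fin n → ℕ) (c : Fin n) :
    Option (Fin n) :=
  ((List.finRange n).rotate c.val).find? fun d => d ∈ B ∧ lower d = 0

/-- One pairing: the ball `p.1` with label `p.2` gives its label to the first unlabelled ball
weakly to its right in the row `B` below. (If no unlabelled ball is left, which cannot happen in a
multiline queue, the ball stays unpaired.) -/
def pairBall {n : ℕ} (B : Finset (Fin n)) (lower : Fin n → ℕ) (p : Fin n × ℕ) : Fin n → ℕ :=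
  match firstUnlabeled B lower p.1 with
  | some d => Function.update lower d p.2
  | none => lower

/-- The labelled row `r`, with set of balls `B`, from the labelled row `upper` above it: first all
balls of the upper row are paired, then the balls of `B` without a label are labelled `r`. -/
def labelRow {n : ℕ} (r : ℕ) (B : Finset (Fin n)) (upper : Fin n → ℕ) : Fin n → ℕ :=
  let paired := (pairingOrder upper).foldl (pairBall B) fun _ => 0
  fun c => if c ∈ B ∧ paired c = 0 then r else paired c

/-- The labels that the algorithm gives to row `r`, where the list consists of the rows
`r, r + 1, …, L`; the algorithm proceeds from the top row to the bottom row. -/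
def labels {n : ℕ} : ℕ → BallArray n → Fin n → ℕ
  | _, [] => fun _ => 0
  | r, B :: rest => labelRow r B (labels (r + 1) rest)

/-- The type of a multiline queue: the labels of row `1`, with `0` for an empty site. -/
def type {n : ℕ} (M : BallArray n) : Fin n → ℕ := labels 1 M

/-! ### Dropping operators and the collapsing map -/

/-- The bracket word of two adjacent rows, `lower` below `upper`, obtained from the column word
(columns from left to right, each from top to bottom): a ball of the upper row in column `c` gives
the opening bracket `(true, c)`, a ball of the lower row the closing bracket `(false, c)`. -/
def bracketWord {n : ℕ} (lower upper : Finset (Fin n)) : List (Bool × Fin n) :=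
  (List.finRange n).flatMap fun c =>
    (if c ∈ upper then [(true, c)] else []) ++ (if c ∈ lower then [(false, c)] else [])

/-- Reading one bracket, with the stack of the so far unmatched opening brackets: a closing bracket
is matched with the nearest unmatched opening bracket to its left, if there is one. -/
def readBracket {n : ℕ} (stack : List (Fin n)) (p : Bool × Fin n) : List (Fin n) :=
  if p.1 then p.2 :: stack else stack.tail

/-- The balls of the upper row that are unmatched in the bracket word. -/
def unmatchedUpper {n : ℕ} (lower upper : Finset (Fin n)) : Finset (Fin n) :=
  ((bracketWord lower upper).foldl readBracket []).toFinset

/-- `dropRow i` drops all unmatched balls of row `i + 2` to row `i + 1` (that is, of the row with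
list index `i + 1` to the row with list index `i`); it is the operator `e_{i+1}^{↓⋆}`. -/
def dropRow {n : ℕ} : ℕ → BallArray n → BallArray n
  | 0, a :: b :: rest => (a ∪ unmatchedUpper a b) :: (b \ unmatchedUpper a b) :: rest
  | i + 1, a :: rest => a :: dropRow i rest
  | _, M => M

/-- `dropCascade i` is `e_1^{↓⋆} ∘ e_2^{↓⋆} ∘ ⋯ ∘ e_i^{↓⋆}` (`e_i^{↓⋆}` is applied first). -/
def dropCascade {n : ℕ} : ℕ → BallArray n → BallArray n
  | 0, M => M
  | i + 1, M => dropCascade i (dropRow i M)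

/-- `collapseRows i` is the composition of `dropCascade 1, dropCascade 2, …, dropCascade i`,
applied in this order; it collapses the rows `1, …, i + 1`. -/
def collapseRows {n : ℕ} : ℕ → BallArray n → BallArray n
  | 0, M => M
  | i + 1, M => dropCascade (i + 1) (collapseRows i M)

/-- The collapsing map `ρ = ρ_N`. -/
def collapse {n : ℕ} (M : BallArray n) : BallArray n := collapseRows (M.length - 1) M

/-- The coinversions of a composition `α`: the pairs `i < j` with `α i < α j`. -/
def coinversions {n : ℕ} (α : Fin n → ℕ) : Set (Fin n × Fin n) :=
  {p | p.1 < p.2 ∧ α p.1 < α p.2}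

end MultilineQueue

/-! The dropping operators are idempotent, commute when far apart and satisfy the braid relations,
and ρ is their longest word. Hence ρ absorbs every operator on both sides (`collapse_dropRow`,
`dropRow_collapse`), and arrays joined by drops have the same collapse. The relations are checked on
heights, the numbers of balls in the last `t` columns: the height of the dropped balls is a running
maximum (`ht_unmatchedUpper`), and the braid relation becomes the max-plus identity `runMax_braid`.

The columns with label above `k` form the set `key M k`, obtained by pairing row `k + 1` cyclically
downwards (`lt_type_iff`). Lifting the unpaired balls of the lower of two rows does not change the
result of dropping (`unmatchedUpper_parked`), so every key set of `M` can be made the bottom row of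
an array with the same collapse (`exists_key_array`). It remains to show that a bottom row `S` with
`j ∈ S`, `i ∉ S`, `i < j` forces some key set of the collapse to separate `j` from `i` in the same
way (`exists_key_collapse`).

To this end the sum of squares of the row sizes, which is bounded, is driven up. Each key set `U` of
the collapsed upper rows can be brought next to `S`. If `S` is `Settled` against all of them, `S` is
itself a key set of the collapse (`exists_eq_key_of_settled`). Otherwise dropping some `U` raises
the sum. If `i` is not dropped, the new bottom row still separates; if `i` is dropped, its part
paired to the balls left above does (`unmatchedUpper_drop_structure`). -/

namespace MultilineQueue

/-! ### Running maxima -/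

/-- The running maximum of an integer sequence. -/
def runMax (d : ℕ → ℤ) : ℕ → ℤ
  | 0 => d 0
  | t + 1 => max (runMax d t) (d (t + 1))

lemma le_runMax (d : ℕ → ℤ) {s t : ℕ} (h : s ≤ t) : d s ≤ runMax d t := by
  induction t with
  | zero => obtain rfl : s = 0 := by omega
            exact le_rfl
  | succ t ih =>
    rcases Nat.lt_or_ge t s with h' | h'
    · obtain rfl : s = t + 1 := by omega
      exact le_max_right _ _
    · exact (ih h').trans (le_max_left _ _)

lemma exists_runMax_eq (d : ℕ → ℤ) (t : ℕ) : ∃ s ≤ t, runMax d t = d s := by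
  induction t with
  | zero => exact ⟨0, le_rfl, rfl⟩
  | succ t ih =>
    obtain ⟨s, hs, h⟩ := ih
    rcases le_total (runMax d t) (d (t + 1)) with h' | h'
    · exact ⟨t + 1, le_rfl, max_eq_right h'⟩
    · exact ⟨s, by omega, (max_eq_left h').trans h⟩

lemma runMax_le (d : ℕ → ℤ) {t : ℕ} {K : ℤ} (h : ∀ s ≤ t, d s ≤ K) : runMax d t ≤ K := by
  obtain ⟨s, hs, e⟩ := exists_runMax_eq d t
  exact e ▸ h s hs

lemma runMax_mono (d : ℕ → ℤ) {s t : ℕ} (h : s ≤ t) : runMax d s ≤ runMax d t :=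
  runMax_le _ fun _ hr => le_runMax d (hr.trans h)

lemma runMax_eq_iff (d : ℕ → ℤ) (t : ℕ) (K : ℤ) :
    runMax d t = K ↔ (∀ s ≤ t, d s ≤ K) ∧ ∃ s ≤ t, d s = K := by
  constructor
  · rintro rfl
    obtain ⟨s, hs, e⟩ := exists_runMax_eq d t
    exact ⟨fun _ h => le_runMax d h, s, hs, e.symm⟩
  · rintro ⟨h, s, hs, e⟩
    exact le_antisymm (runMax_le d h) (e ▸ le_runMax d hs)

/-- Between `s` and `t`, the reflected sequence `d - 2 * runMax d` yields no larger values than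
`d`. -/
lemma exists_ge_reflect (d : ℕ → ℤ) {s r t : ℕ} (hsr : s ≤ r) (hrt : r ≤ t) :
    ∃ r', s ≤ r' ∧ r' ≤ t ∧ d r - 2 * runMax d r + runMax d t + runMax d s ≤ d r' := by
  have h1 := runMax_mono d hsr
  have h2 := runMax_mono d hrt
  have h3 := le_runMax d (le_refl r)
  obtain ⟨r', hr', e⟩ := exists_runMax_eq d t
  rcases Nat.lt_or_ge r' s with h | h
  · have := le_runMax d h.le
    exact ⟨r, hsr, hrt, by omega⟩
  · exact ⟨r', h, hr', by omega⟩

lemma exists_reflect_ge (d : ℕ → ℤ) (hd : ∀ t, d (t + 1) ≤ d t + 1) {s r t : ℕ} (hsr : s ≤ r)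
    (hrt : r ≤ t) :
    ∃ r', s ≤ r' ∧ r' ≤ t ∧ d r ≤ d r' - 2 * runMax d r' + runMax d t + runMax d s := by
  have h1 := runMax_mono d hsr
  have h2 := runMax_mono d hrt
  rcases eq_or_lt_of_le (h1.trans h2) with h | h
  · exact ⟨r, hsr, hrt, by omega⟩
  · have h3 := le_runMax d hrt
    suffices ∃ r', s ≤ r' ∧ r' ≤ t ∧ runMax d r' = runMax d s ∧ d r' = runMax d s by
      obtain ⟨r', a, b, c, e⟩ := this
      exact ⟨r', a, b, by omega⟩
    clear h1 h2 h3 hrt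
    have hst : s ≤ t := by
      by_contra hh
      exact absurd (runMax_mono d (show t ≤ s by omega)) (by omega)
    induction t, hst using Nat.le_induction with
    | base => omega
    | succ t hst ih =>
      rcases eq_or_lt_of_le (runMax_mono d hst) with h' | h'
      -- `t` is the last time at which the maximum is still `runMax d s`. An upward step of at most
      -- one then exceeds it, so `d t` already equals it.
      · refine ⟨t, hst, by omega, h'.symm, ?_⟩
        have e : runMax d (t + 1) = max (runMax d t) (d (t + 1)) := rfl
        have := hd t
        have := le_runMax d (le_refl t)
        omega
      · obtain ⟨r', a, b, c⟩ := ih h'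
        exact ⟨r', a, by omega, c⟩

/-- The identity behind the braid relation of the dropping operators. -/
lemma runMax_braid (d g : ℕ → ℤ) (hd : ∀ t, d (t + 1) ≤ d t + 1) (t : ℕ) :
    runMax (fun r => d r - 2 * runMax d r + runMax (fun s => g s + runMax d s) r) t + runMax d t =
      runMax (fun r => d r + runMax g r) t := by
  -- Both sides are maxima over pairs `s ≤ r ≤ t`. For fixed `s` the terms in `g` agree, and the
  -- maxima over `r` are compared by the two reflection lemmas.
  apply le_antisymm
  · obtain ⟨r, hr, e⟩ := exists_runMax_eq
      (fun r => d r - 2 * runMax d r + runMax (fun s => g s + runMax d s) r) t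
    obtain ⟨s, hs, e'⟩ := exists_runMax_eq (fun s => g s + runMax d s) r
    obtain ⟨r', h1, h2, h3⟩ := exists_ge_reflect d hs hr
    have h4 := le_runMax (fun r => d r + runMax g r) h2
    have h5 := le_runMax g h1
    omega
  · obtain ⟨r, hr, e⟩ := exists_runMax_eq (fun r => d r + runMax g r) t
    obtain ⟨s, hs, e'⟩ := exists_runMax_eq g r
    obtain ⟨r', h1, h2, h3⟩ := exists_reflect_ge d hd hs hr
    have h4 := le_runMax
      (fun r => d r - 2 * runMax d r + runMax (fun s => g s + runMax d s) r) h2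
    have h5 := le_runMax (fun s => g s + runMax d s) h1
    omega

/-! ### Heights -/

variable {n : ℕ}

/-- Whether the column `n - t` (in the numbering `1, …, n`) belongs to `B`. -/
def ind (B : Finset (Fin n)) (t : ℕ) : ℤ := if ∃ x ∈ B, (x : ℕ) + t + 1 = n then 1 else 0

/-- The number of elements of `B` in the last `t` columns. -/
def ht (B : Finset (Fin n)) (t : ℕ) : ℤ := ∑ s ∈ Finset.range t, ind B s

@[simp] lemma ht_zero (B : Finset (Fin n)) : ht B 0 = 0 := rfl

lemma ht_succ (B : Finset (Fin n)) (t : ℕ) : ht B (t + 1) = ht B t + ind B t :=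
  Finset.sum_range_succ _ _

lemma ind_rev (B : Finset (Fin n)) (x : Fin n) : ind B x.rev = if x ∈ B then 1 else 0 := by
  unfold ind
  congr 1
  refine propext ⟨?_, fun h => ⟨x, h, by have := x.2; simp only [Fin.val_rev]; omega⟩⟩
  rintro ⟨y, hy, e⟩
  have : y = x := by
    have := x.2
    simp only [Fin.val_rev] at e
    ext; omega
  exact this ▸ hy

lemma ind_of_le (B : Finset (Fin n)) {t : ℕ} (h : n ≤ t) : ind B t = 0 := by
  unfold ind
  rw [if_neg]
  rintro ⟨y, hy, e⟩
  omega

lemma exists_rev_eq {t : ℕ} (h : t < n) : ∃ x : Fin n, (x.rev : ℕ) = t :=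
  ⟨Fin.rev ⟨t, h⟩, by rw [Fin.rev_rev]⟩

/-- To prove something about all columns `n - t`, distinguish actual columns from the rest. -/
lemma ind_cases {P : ℕ → Prop} (h1 : ∀ x : Fin n, P x.rev) (h2 : ∀ t, n ≤ t → P t) (t : ℕ) :
    P t := by
  rcases Nat.lt_or_ge t n with h | h
  · obtain ⟨x, rfl⟩ := exists_rev_eq h
    exact h1 x
  · exact h2 t h

lemma ind_nonneg (B : Finset (Fin n)) (t : ℕ) : 0 ≤ ind B t := by
  unfold ind; split_ifs <;> simp

lemma ind_le_one (B : Finset (Fin n)) (t : ℕ) : ind B t ≤ 1 := by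
  unfold ind; split_ifs <;> simp

lemma ht_mono (B : Finset (Fin n)) {s t : ℕ} (h : s ≤ t) : ht B s ≤ ht B t := by
  induction t, h using Nat.le_induction with
  | base => rfl
  | succ t _ ih => rw [ht_succ]; have := ind_nonneg B t; omega

lemma ht_nonneg (B : Finset (Fin n)) (t : ℕ) : 0 ≤ ht B t := ht_mono B (Nat.zero_le t)

lemma ind_union_of_disjoint {A B : Finset (Fin n)} (h : Disjoint A B) (t : ℕ) :
    ind (A ∪ B) t = ind A t + ind B t := by
  induction t using ind_cases (n := n) with
  | h1 x =>
    simp only [ind_rev, Finset.mem_union]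
    have : ¬ (x ∈ A ∧ x ∈ B) := fun hx => Finset.disjoint_left.1 h hx.1 hx.2
    split_ifs <;> simp_all
  | h2 t ht => simp [ind_of_le _ ht]

lemma ht_union_of_disjoint {A B : Finset (Fin n)} (h : Disjoint A B) (t : ℕ) :
    ht (A ∪ B) t = ht A t + ht B t := by
  simp only [ht, ind_union_of_disjoint h, Finset.sum_add_distrib]

lemma ht_sdiff {A B : Finset (Fin n)} (h : B ⊆ A) (t : ℕ) : ht (A \ B) t = ht A t - ht B t := by
  have := ht_union_of_disjoint (Finset.sdiff_disjoint (s := B) (t := A)) t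
  rw [Finset.sdiff_union_of_subset h] at this
  omega

lemma ind_mono {A B : Finset (Fin n)} (h : A ⊆ B) (t : ℕ) : ind A t ≤ ind B t := by
  unfold ind
  split_ifs with h1 h2
  · rfl
  · obtain ⟨x, hx, e⟩ := h1
    exact absurd ⟨x, h hx, e⟩ h2
  · simp
  · rfl

lemma ht_sub_le_of_subset {A B : Finset (Fin n)} (h : A ⊆ B) {s t : ℕ} (hst : s ≤ t) :
    ht A t - ht A s ≤ ht B t - ht B s := by
  induction t, hst using Nat.le_induction with
  | base => simp
  | succ t _ ih => rw [ht_succ, ht_succ]; have := ind_mono h t; omega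

lemma ht_le_of_subset {A B : Finset (Fin n)} (h : A ⊆ B) (t : ℕ) : ht A t ≤ ht B t := by
  simpa using ht_sub_le_of_subset h (Nat.zero_le t)

lemma ht_card (B : Finset (Fin n)) : ht B n = B.card := by
  have h1 : ht B n = ∑ x : Fin n, ind B x := (Fin.sum_univ_eq_sum_range _ n).symm
  rw [h1, ← Equiv.sum_comp Fin.revPerm]
  simp only [Fin.revPerm_apply, ind_rev]
  simp

lemma ht_of_le (B : Finset (Fin n)) {t : ℕ} (h : n ≤ t) : ht B t = B.card := by
  induction t, h using Nat.le_induction with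
  | base => exact ht_card B
  | succ t h ih => rw [ht_succ, ih, ind_of_le _ h, add_zero]

lemma ht_le_card (B : Finset (Fin n)) (t : ℕ) : ht B t ≤ B.card := by
  rcases le_total t n with h | h
  · exact ht_card B ▸ ht_mono B h
  · exact (ht_of_le B h).le

lemma eq_of_ht_eq {A B : Finset (Fin n)} (h : ∀ t, ht A t = ht B t) : A = B := by
  ext x
  have h1 := h (x.rev + 1)
  rw [ht_succ, ht_succ, h, ind_rev, ind_rev] at h1
  by_cases ha : x ∈ A <;> by_cases hb : x ∈ B <;> simp_all

/-! ### The unmatched balls -/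

/-- The unmatched upper balls among the given columns, and the number of unmatched lower balls. -/
def scan (B A : Finset (Fin n)) : List (Fin n) → List (Fin n) × ℕ
  | [] => ([], 0)
  | c :: l =>
    let p := scan B A l
    if c ∈ A then
      if c ∈ B then p else if p.2 = 0 then (p.1 ++ [c], 0) else (p.1, p.2 - 1)
    else if c ∈ B then (p.1, p.2 + 1) else p

/-- A segment acts on any stack by popping once for each of its unmatched closing brackets and then
pushing its unmatched opening ones. -/
lemma foldl_readBracket (B A : Finset (Fin n)) (l st : List (Fin n)) :
    (l.flatMap fun c => (if c ∈ A then [(true, c)] else []) ++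
      (if c ∈ B then [(false, c)] else [])).foldl readBracket st =
      (scan B A l).1 ++ st.drop (scan B A l).2 := by
  induction l generalizing st with
  | nil => simp [scan]
  | cons c l ih =>
    rw [List.flatMap_cons, List.foldl_append, ih]
    simp only [scan]
    by_cases ha : c ∈ A <;> by_cases hb : c ∈ B
    · simp [ha, hb, readBracket]
    · by_cases h0 : (scan B A l).2 = 0
      · simp [ha, hb, readBracket, h0]
      · obtain ⟨k, hk⟩ := Nat.exists_eq_succ_of_ne_zero h0
        simp [ha, hb, readBracket, hk]
    · simp [ha, hb, readBracket, List.drop_tail]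
    · simp [ha, hb]

lemma unmatchedUpper_eq_scan (B A : Finset (Fin n)) :
    unmatchedUpper B A = (scan B A (List.finRange n)).1.toFinset := by
  simp [unmatchedUpper, bracketWord, foldl_readBracket]

/-- The last `t` columns. -/
def lastCols (n t : ℕ) : List (Fin n) := (List.finRange n).drop (n - t)

lemma lastCols_rev (x : Fin n) : lastCols n (x.rev + 1) = x :: lastCols n x.rev := by
  have hx := x.2
  have e : n - ((x.rev : ℕ) + 1) = x := by simp only [Fin.val_rev]; omega
  have e' : n - (x.rev : ℕ) = x + 1 := by simp only [Fin.val_rev]; omega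
  rw [lastCols, lastCols, e, e', List.drop_eq_getElem_cons (by simp)]
  simp

/-- Seen from the right, the surplus of lower balls is a queue length: it follows `ht B - ht A`,
held at `0` whenever an upper ball finds no partner. The running maximum counts these occasions. -/
lemma scan_lastCols (B A : Finset (Fin n)) (t : ℕ) (ht' : t ≤ n) :
    ((scan B A (lastCols n t)).2 : ℤ) = ht B t - ht A t + runMax (fun s => ht A s - ht B s) t ∧
    (∀ x, x ∈ (scan B A (lastCols n t)).1 ↔ (x.rev : ℕ) < t ∧ x ∈ A ∧ x ∉ B ∧
      (scan B A (lastCols n x.rev)).2 = 0) := by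
  induction t with
  | zero =>
    have e : lastCols n 0 = [] := by simp [lastCols]
    simp [e, scan, runMax]
  | succ t ih =>
    obtain ⟨h1, h2⟩ := ih (by omega)
    obtain ⟨c, rfl⟩ := exists_rev_eq (n := n) (t := t) (by omega)
    have key : ∀ x : Fin n, (x.rev : ℕ) < c.rev + 1 ↔ (x.rev : ℕ) < c.rev ∨ x = c := by
      intro x
      have := x.2
      have := c.2
      rw [Fin.ext_iff]; simp only [Fin.val_rev]; omega
    have hm := le_runMax (fun s => ht A s - ht B s) (le_refl (c.rev : ℕ))
    constructor
    · rw [lastCols_rev, scan, runMax, ht_succ, ht_succ, ind_rev, ind_rev]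
      by_cases ha : c ∈ A <;> by_cases hb : c ∈ B
      · simp only [ha, hb, if_true]; omega
      · by_cases h0 : (scan B A (lastCols n c.rev)).2 = 0
        · simp only [ha, hb, if_true, if_false, h0]; omega
        · simp only [ha, hb, if_true, if_false, h0]; omega
      · simp only [ha, hb, if_true, if_false]; push_cast; omega
      · simp only [ha, hb, if_false]; omega
    · intro x
      rw [key, lastCols_rev, scan]
      by_cases hxc : x = c
      · subst hxc
        have : ¬ x ∈ (scan B A (lastCols n x.rev)).1 := by
          rw [h2]; simp
        by_cases ha : x ∈ A <;> by_cases hb : x ∈ B <;>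
          by_cases h0 : (scan B A (lastCols n x.rev)).2 = 0 <;>
          simp [-Fin.val_rev, ha, hb, h0, this]
      · by_cases ha : c ∈ A <;> by_cases hb : c ∈ B <;>
          by_cases h0 : (scan B A (lastCols n c.rev)).2 = 0 <;>
          simp [-Fin.val_rev, ha, hb, h0, hxc, h2]

lemma mem_unmatchedUpper (B A : Finset (Fin n)) (x : Fin n) :
    x ∈ unmatchedUpper B A ↔ x ∈ A ∧ x ∉ B ∧
      ht B x.rev - ht A x.rev + runMax (fun s => ht A s - ht B s) x.rev = 0 := by
  have h := scan_lastCols B A n le_rfl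
  have e : lastCols n n = List.finRange n := by simp [lastCols]
  rw [e] at h
  have hx := x.rev.2
  rw [unmatchedUpper_eq_scan, List.mem_toFinset, h.2, ← (scan_lastCols B A x.rev hx.le).1,
    Nat.cast_eq_zero]
  exact and_iff_right hx

lemma unmatchedUpper_subset (B A : Finset (Fin n)) : unmatchedUpper B A ⊆ A :=
  fun _ hx => ((mem_unmatchedUpper B A _).1 hx).1

lemma disjoint_unmatchedUpper (B A : Finset (Fin n)) : Disjoint B (unmatchedUpper B A) :=
  Finset.disjoint_right.2 fun _ hx => ((mem_unmatchedUpper B A _).1 hx).2.1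

/-- Unmatched upper balls sit exactly where `ht A - ht B` reaches a new maximum. -/
lemma ht_unmatchedUpper (B A : Finset (Fin n)) (t : ℕ) :
    ht (unmatchedUpper B A) t = runMax (fun s => ht A s - ht B s) t := by
  induction t with
  | zero => simp [runMax]
  | succ t ih =>
    have hm := le_runMax (fun s => ht A s - ht B s) (le_refl t)
    rw [ht_succ, ih, runMax, ht_succ, ht_succ]
    induction t using ind_cases (n := n) with
    | h1 x =>
      simp only [ind_rev, mem_unmatchedUpper]
      by_cases ha : x ∈ A <;> by_cases hb : x ∈ B <;> simp only [ha, hb, if_true, if_false,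
        true_and, false_and, not_true, not_false_eq_true]
      · omega
      · split_ifs <;> omega
      · omega
      · omega
    | h2 t h =>
      simp only [ind_of_le _ h]; omega

/-- The lower row after dropping. -/
def dropLower (B A : Finset (Fin n)) : Finset (Fin n) := B ∪ unmatchedUpper B A

/-- The upper row after dropping. -/
def dropUpper (B A : Finset (Fin n)) : Finset (Fin n) := A \ unmatchedUpper B A

lemma ht_dropLower (B A : Finset (Fin n)) (t : ℕ) :
    ht (dropLower B A) t = ht B t + runMax (fun s => ht A s - ht B s) t := by
  rw [dropLower, ht_union_of_disjoint (disjoint_unmatchedUpper B A), ht_unmatchedUpper]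

lemma ht_dropUpper (B A : Finset (Fin n)) (t : ℕ) :
    ht (dropUpper B A) t = ht A t - runMax (fun s => ht A s - ht B s) t := by
  rw [dropUpper, ht_sdiff (unmatchedUpper_subset B A), ht_unmatchedUpper]

/-- The upper row `A` is completely matched to the lower row `B`. -/
def Dominates (B A : Finset (Fin n)) : Prop := ∀ t, ht A t ≤ ht B t

lemma Dominates.trans {A B C : Finset (Fin n)} (h : Dominates C B) (h' : Dominates B A) :
    Dominates C A := fun t => (h' t).trans (h t)

lemma Dominates.card_le {A B : Finset (Fin n)} (h : Dominates B A) : A.card ≤ B.card := by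
  have := h n
  rw [ht_card, ht_card] at this
  exact_mod_cast this

lemma dominates_of_subset {A B : Finset (Fin n)} (h : A ⊆ B) : Dominates B A := ht_le_of_subset h

lemma unmatchedUpper_eq_empty_iff {A B : Finset (Fin n)} :
    unmatchedUpper B A = ∅ ↔ Dominates B A := by
  constructor
  · intro h t
    have h1 := ht_unmatchedUpper B A t
    have h2 := le_runMax (fun s => ht A s - ht B s) (le_refl t)
    have h3 : ht (∅ : Finset (Fin n)) t ≤ (∅ : Finset (Fin n)).card := ht_le_card _ _
    simp only [h, Finset.card_empty] at *
    omega
  · intro h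
    rw [← Finset.card_eq_zero]
    have h1 := ht_unmatchedUpper B A n
    have h2 := runMax_le (fun s => ht A s - ht B s) (t := n) (K := 0)
      (fun s _ => by have := h s; omega)
    rw [ht_card] at h1
    omega

lemma dominates_drop (B A : Finset (Fin n)) : Dominates (dropLower B A) (dropUpper B A) := by
  intro t
  rw [ht_dropLower, ht_dropUpper]
  have := le_runMax (fun s => ht A s - ht B s) (le_refl t)
  have := le_runMax (fun s => ht A s - ht B s) (Nat.zero_le t)
  simp only [ht_zero] at *
  omega

lemma Dominates.dropLower_eq {A B : Finset (Fin n)} (h : Dominates B A) : dropLower B A = B := by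
  rw [dropLower, unmatchedUpper_eq_empty_iff.2 h, Finset.union_empty]

lemma Dominates.dropUpper_eq {A B : Finset (Fin n)} (h : Dominates B A) : dropUpper B A = A := by
  rw [dropUpper, unmatchedUpper_eq_empty_iff.2 h, Finset.sdiff_empty]

lemma card_dropLower (B A : Finset (Fin n)) :
    (dropLower B A).card = B.card + (unmatchedUpper B A).card :=
  Finset.card_union_of_disjoint (disjoint_unmatchedUpper B A)

lemma card_dropUpper (B A : Finset (Fin n)) :
    (dropUpper B A).card + (unmatchedUpper B A).card = A.card :=
  Finset.card_sdiff_add_card_eq_card (unmatchedUpper_subset B A)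

lemma card_dropUpper_le (B A : Finset (Fin n)) : (dropUpper B A).card ≤ B.card := by
  have h1 := ht_dropUpper B A n
  have h2 := le_runMax (fun s => ht A s - ht B s) (le_refl n)
  simp only [ht_card] at *
  omega

/-! ### The braid relation -/

section Braid

variable (a b c : Finset (Fin n))

lemma ht_sub_ht_succ_le (A B : Finset (Fin n)) (t : ℕ) :
    ht A (t + 1) - ht B (t + 1) ≤ ht A t - ht B t + 1 := by
  rw [ht_succ, ht_succ]
  have := ind_le_one A t
  have := ind_nonneg B t
  omega

lemma braid_lower :
    dropLower (dropLower a b) (dropLower (dropUpper a b) c) = dropLower a (dropLower b c) := by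
  apply eq_of_ht_eq
  intro t
  have h := runMax_braid (fun s => ht b s - ht a s) (fun s => ht c s - ht b s)
    (ht_sub_ht_succ_le b a) t
  simp only [ht_dropLower, ht_dropUpper] at *
  have e1 : (fun s => ht b s - runMax (fun s => ht b s - ht a s) s +
      runMax (fun s => ht c s - (ht b s - runMax (fun s => ht b s - ht a s) s)) s -
      (ht a s + runMax (fun s => ht b s - ht a s) s)) =
      fun r => ht b r - ht a r - 2 * runMax (fun s => ht b s - ht a s) r +
      runMax (fun s => ht c s - ht b s + runMax (fun s => ht b s - ht a s) s) r := by
    funext s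
    have : (fun s => ht c s - (ht b s - runMax (fun s => ht b s - ht a s) s)) =
      fun s => ht c s - ht b s + runMax (fun s => ht b s - ht a s) s := by
      funext s; ring
    rw [this]; ring
  have e2 : (fun s => ht b s + runMax (fun s => ht c s - ht b s) s - ht a s) =
      fun r => ht b r - ht a r + runMax (fun s => ht c s - ht b s) r := by
    funext s; ring
  rw [e1, e2, ← h]; ring

lemma braid_upper :
    dropUpper (dropUpper a b) c =
      dropUpper (dropUpper a (dropLower b c)) (dropUpper b c) := by
  apply eq_of_ht_eq
  intro t
  have h := runMax_braid (fun s => ht c s - ht b s) (fun s => ht b s - ht a s)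
    (ht_sub_ht_succ_le c b) t
  simp only [ht_dropLower, ht_dropUpper] at *
  have e1 : (fun s => ht c s - runMax (fun s => ht c s - ht b s) s -
      (ht b s + runMax (fun s => ht c s - ht b s) s -
      runMax (fun s => ht b s + runMax (fun s => ht c s - ht b s) s - ht a s) s)) =
      fun r => ht c r - ht b r - 2 * runMax (fun s => ht c s - ht b s) r +
      runMax (fun s => ht b s - ht a s + runMax (fun s => ht c s - ht b s) s) r := by
    funext s
    have : (fun s => ht b s + runMax (fun s => ht c s - ht b s) s - ht a s) =
      fun s => ht b s - ht a s + runMax (fun s => ht c s - ht b s) s := by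
      funext s; ring
    rw [this]; ring
  have e2 : (fun s => ht c s - (ht b s - runMax (fun s => ht b s - ht a s) s)) =
      fun r => ht c r - ht b r + runMax (fun s => ht b s - ht a s) r := by
    funext s; ring
  rw [e1, e2, ← h]; ring

lemma ht_drop_add (B A : Finset (Fin n)) (t : ℕ) :
    ht (dropLower B A) t + ht (dropUpper B A) t = ht B t + ht A t := by
  rw [ht_dropLower, ht_dropUpper]; ring

/-- Dropping preserves the total height of the rows, so agreement of the two outer rows forces that
of the middle one. -/
lemma braid_middle :
    dropUpper (dropLower a b) (dropLower (dropUpper a b) c) =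
      dropLower (dropUpper a (dropLower b c)) (dropUpper b c) := by
  apply eq_of_ht_eq
  intro t
  have h1 := congrArg (ht · t) (braid_lower a b c)
  have h2 := congrArg (ht · t) (braid_upper a b c)
  have h3 := ht_drop_add (dropLower a b) (dropLower (dropUpper a b) c) t
  have h4 := ht_drop_add (dropUpper a b) c t
  have h5 := ht_drop_add a b t
  have h6 := ht_drop_add (dropUpper a (dropLower b c)) (dropUpper b c) t
  have h7 := ht_drop_add a (dropLower b c) t
  have h8 := ht_drop_add b c t
  omega

end Braid


/-! ### Relations between the dropping operators -/

@[simp] lemma dropRow_zero_cons_cons (a b : Finset (Fin n)) (M : BallArray n) :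
    dropRow 0 (a :: b :: M) = dropLower a b :: dropUpper a b :: M := rfl

@[simp] lemma dropRow_succ_cons (i : ℕ) (a : Finset (Fin n)) (M : BallArray n) :
    dropRow (i + 1) (a :: M) = a :: dropRow i M := rfl

@[simp] lemma dropRow_nil (i : ℕ) : dropRow i ([] : BallArray n) = [] := by
  cases i <;> rfl

@[simp] lemma dropRow_singleton (i : ℕ) (a : Finset (Fin n)) : dropRow i [a] = [a] := by
  cases i <;> simp [dropRow]

lemma dropRow_of_length_le (i : ℕ) (M : BallArray n) (h : M.length ≤ i + 1) :
    dropRow i M = M := by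
  induction i generalizing M with
  | zero =>
    match M, h with
    | [], _ => rfl
    | [a], _ => rfl
  | succ i ih =>
    match M, h with
    | [], _ => rfl
    | a :: M, h => rw [dropRow_succ_cons, ih M (by simpa using h)]

@[simp] lemma length_dropRow (i : ℕ) (M : BallArray n) : (dropRow i M).length = M.length := by
  induction i generalizing M with
  | zero =>
    match M with
    | [] => rfl
    | [a] => rfl
    | a :: b :: M => rfl
  | succ i ih =>
    match M with
    | [] => rfl
    | a :: M => simp [ih]

lemma dropRow_idem (i : ℕ) (M : BallArray n) : dropRow i (dropRow i M) = dropRow i M := by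
  induction i generalizing M with
  | zero =>
    match M with
    | [] => rfl
    | [a] => rfl
    | a :: b :: M =>
      simp [(dominates_drop a b).dropLower_eq, (dominates_drop a b).dropUpper_eq]
  | succ i ih =>
    match M with
    | [] => rfl
    | a :: M => simp [ih]

lemma dropRow_comm (i k : ℕ) (M : BallArray n) :
    dropRow i (dropRow (i + k + 2) M) = dropRow (i + k + 2) (dropRow i M) := by
  induction i generalizing M with
  | zero =>
    match M with
    | [] => simp
    | [a] => simp
    | a :: b :: M =>
      rw [show 0 + k + 2 = (k + 1) + 1 by omega]
      simp
  | succ i ih =>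
    match M with
    | [] => simp
    | a :: M =>
      rw [show i + 1 + k + 2 = (i + k + 2) + 1 by omega]
      simp [ih]

lemma dropRow_comm_of_lt {i j : ℕ} (h : i + 1 < j) (M : BallArray n) :
    dropRow i (dropRow j M) = dropRow j (dropRow i M) := by
  obtain ⟨k, rfl⟩ := Nat.exists_eq_add_of_lt h
  rw [show i + 1 + k + 1 = i + k + 2 by omega]
  exact dropRow_comm i k M

lemma dropRow_braid (i : ℕ) (M : BallArray n) :
    dropRow i (dropRow (i + 1) (dropRow i M)) =
      dropRow (i + 1) (dropRow i (dropRow (i + 1) M)) := by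
  induction i generalizing M with
  | zero =>
    match M with
    | [] => simp
    | [a] => simp
    -- With only two rows the upper operator is trivial, and the relation reduces to idempotence.
    | [a, b] => simp [(dominates_drop a b).dropLower_eq, (dominates_drop a b).dropUpper_eq]
    | a :: b :: c :: M => simp [braid_lower, braid_middle, ← braid_upper]
  | succ i ih =>
    match M with
    | [] => simp
    | a :: M => simp [ih]

@[simp] lemma length_dropCascade (k : ℕ) (M : BallArray n) :
    (dropCascade k M).length = M.length := by
  induction k generalizing M with
  | zero => rfl
  | succ k ih => rw [dropCascade, ih, length_dropRow]

@[simp] lemma length_collapseRows (k : ℕ) (M : BallArray n) :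
    (collapseRows k M).length = M.length := by
  induction k with
  | zero => rfl
  | succ k ih => rw [collapseRows, length_dropCascade, ih]

lemma dropRow_dropCascade_of_lt {i k : ℕ} (h : k < i) (M : BallArray n) :
    dropRow i (dropCascade k M) = dropCascade k (dropRow i M) := by
  induction k generalizing M with
  | zero => rfl
  | succ k ih => rw [dropCascade, dropCascade, ih (by omega), dropRow_comm_of_lt h]

/-- By the braid relation an operator passes through a cascade with its index lowered by one. Going
through successive cascades it reaches index `0`, where it is absorbed. -/
lemma dropRow_succ_dropCascade {i k : ℕ} (h : i + 1 < k) (M : BallArray n) :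
    dropRow (i + 1) (dropCascade k M) = dropCascade k (dropRow i M) := by
  induction k generalizing M with
  | zero => omega
  | succ k ih =>
    rcases Nat.lt_or_ge (i + 1) k with hk | hk
    · rw [dropCascade, dropCascade, ih hk, dropRow_comm_of_lt hk]
    · obtain rfl : k = i + 1 := by omega
      simp only [dropCascade]
      rw [dropRow_dropCascade_of_lt (by omega), dropRow_braid]

lemma dropRow_zero_dropCascade (k : ℕ) (M : BallArray n) :
    dropRow 0 (dropCascade (k + 1) M) = dropCascade (k + 1) M := by
  induction k generalizing M with
  | zero => exact dropRow_idem 0 M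
  | succ k ih => rw [dropCascade, ih]

lemma dropRow_collapseRows {i k : ℕ} (h : i < k) (M : BallArray n) :
    dropRow i (collapseRows k M) = collapseRows k M := by
  induction k generalizing i with
  | zero => omega
  | succ k ih =>
    cases i with
    | zero => exact dropRow_zero_dropCascade k _
    | succ i => rw [collapseRows, dropRow_succ_dropCascade h, ih (by omega)]

lemma dropRow_collapseRows_of_lt {i k : ℕ} (h : k < i) (M : BallArray n) :
    dropRow i (collapseRows k M) = collapseRows k (dropRow i M) := by
  induction k with
  | zero => rfl
  | succ k ih =>
    rw [collapseRows, collapseRows, dropRow_dropCascade_of_lt h, ih (by omega)]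

/-- This gives absorption on the right: the operator of largest index commutes past the earlier
cascades and meets the last two. -/
lemma dropCascade_dropCascade_dropRow (k : ℕ) (M : BallArray n) :
    dropCascade (k + 1) (dropCascade k (dropRow k M)) =
      dropCascade (k + 1) (dropCascade k M) := by
  induction k generalizing M with
  | zero => exact dropRow_idem 0 M
  | succ k ih =>
    have e : ∀ X : BallArray n, dropCascade (k + 2) (dropCascade (k + 1) X) =
        dropCascade (k + 1) (dropCascade k (dropRow (k + 1) (dropRow k X))) := by
      intro X
      rw [← dropRow_dropCascade_of_lt (by omega)]
      rfl
    rw [e, e, ← dropRow_braid, ih]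

lemma collapseRows_dropRow {i k : ℕ} (h : i < k) (M : BallArray n) :
    collapseRows k (dropRow i M) = collapseRows k M := by
  induction k generalizing M with
  | zero => omega
  | succ k ih =>
    rcases Nat.lt_or_ge i k with hk | hk
    · rw [collapseRows, collapseRows, ih hk]
    · obtain rfl : i = k := by omega
      cases i with
      | zero => exact dropRow_idem 0 M
      | succ i =>
        simp only [collapseRows]
        rw [← dropRow_collapseRows_of_lt (by omega), dropCascade_dropCascade_dropRow]

/-! ### Invariance of the collapse under dropping. -/

@[simp] lemma length_collapse (M : BallArray n) : (collapse M).length = M.length :=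
  length_collapseRows _ _

lemma collapse_dropRow (i : ℕ) (M : BallArray n) : collapse (dropRow i M) = collapse M := by
  rcases Nat.lt_or_ge i (M.length - 1) with h | h
  · rw [collapse, length_dropRow, collapseRows_dropRow h, collapse]
  · rw [dropRow_of_length_le i M (by omega)]

lemma dropRow_collapse (i : ℕ) (M : BallArray n) : dropRow i (collapse M) = collapse M := by
  rcases Nat.lt_or_ge i (M.length - 1) with h | h
  · exact dropRow_collapseRows h M
  · exact dropRow_of_length_le i _ (by rw [length_collapse]; omega)

/-- A property of arrays that is preserved by the dropping operators is preserved by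
`collapse`. -/
lemma collapse_induction {P : BallArray n → Prop} (M : BallArray n)
    (hP : ∀ i X, P X → P (dropRow i X)) (hM : P M) : P (collapse M) := by
  have h1 : ∀ k X, P X → P (dropCascade k X) := by
    intro k
    induction k with
    | zero => exact fun _ h => h
    | succ k ih => exact fun X h => ih _ (hP k X h)
  have h2 : ∀ k, P (collapseRows k M) := by
    intro k
    induction k with
    | zero => exact hM
    | succ k ih => exact h1 _ _ ih
  exact h2 _

lemma collapse_cons_collapse (S : Finset (Fin n)) (C : BallArray n) :
    collapse (S :: collapse C) = collapse (S :: C) := by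
  refine collapse_induction (P := fun X => collapse (S :: X) = collapse (S :: C)) C ?_ rfl
  intro i X h
  rw [← dropRow_succ_cons, collapse_dropRow, h]

lemma collapse_cons_congr (S : Finset (Fin n)) {C C' : BallArray n}
    (h : collapse C = collapse C') : collapse (S :: C) = collapse (S :: C') := by
  rw [← collapse_cons_collapse, h, collapse_cons_collapse]

lemma collapse_cons_cons (a b : Finset (Fin n)) (M : BallArray n) :
    collapse (dropLower a b :: dropUpper a b :: M) = collapse (a :: b :: M) :=
  collapse_dropRow 0 (a :: b :: M)

/-! ### Nonwrapping arrays -/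

/-- Every row is completely matched to the row below it. -/
def Nonwrapping (M : BallArray n) : Prop := M.IsChain Dominates

lemma nonwrapping_of_dropRow_eq {M : BallArray n} (h : ∀ i, dropRow i M = M) :
    Nonwrapping M := by
  induction M with
  | nil => exact List.IsChain.nil
  | cons a M ih =>
    have h2 : Nonwrapping M := ih fun i => by simpa using h (i + 1)
    match M, h, h2 with
    | [], _, _ => exact List.IsChain.singleton a
    | b :: M, h, h2 =>
      have h1 := h 0
      simp only [dropRow_zero_cons_cons, List.cons.injEq] at h1
      have := dominates_drop a b
      rw [h1.1, h1.2.1] at this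
      exact List.IsChain.cons_cons this h2

lemma Nonwrapping.dropRow_eq {M : BallArray n} (h : Nonwrapping M) (i : ℕ) :
    dropRow i M = M := by
  induction i generalizing M with
  | zero =>
    match M, h with
    | [], _ => rfl
    | [a], _ => rfl
    | a :: b :: M, h =>
      have := (List.isChain_cons_cons.1 h).1
      simp [this.dropLower_eq, this.dropUpper_eq]
  | succ i ih =>
    match M, h with
    | [], _ => rfl
    | a :: M, h => rw [dropRow_succ_cons, ih (List.IsChain.of_cons h)]

lemma nonwrapping_collapse (M : BallArray n) : Nonwrapping (collapse M) :=
  nonwrapping_of_dropRow_eq fun i => dropRow_collapse i M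

lemma Nonwrapping.collapse_eq {M : BallArray n} (h : Nonwrapping M) : collapse M = M := by
  refine collapse_induction (P := fun X => X = M) M ?_ rfl
  rintro i X rfl
  exact h.dropRow_eq i

/-- The sizes of the rows decrease weakly from bottom to top. -/
def Descending (M : BallArray n) : Prop := M.Pairwise fun B A => A.card ≤ B.card

lemma Nonwrapping.descending {M : BallArray n} (h : Nonwrapping M) : Descending M := by
  have : IsTrans (Finset (Fin n)) fun B A => A.card ≤ B.card := ⟨fun _ _ _ h h' => h'.trans h⟩
  refine List.isChain_iff_pairwise.1 (List.IsChain.imp (fun _ _ h => ?_) h)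
  exact h.card_le

/-! ### The square norm of the row sizes -/

/-- The sum of the squares of the row sizes. -/
def sqNorm (M : BallArray n) : ℕ := (M.map fun B => B.card ^ 2).sum

@[simp] lemma sqNorm_cons (a : Finset (Fin n)) (M : BallArray n) :
    sqNorm (a :: M) = a.card ^ 2 + sqNorm M := by simp [sqNorm]

lemma sqNorm_le (M : BallArray n) : sqNorm M ≤ M.length * n ^ 2 := by
  induction M with
  | nil => simp [sqNorm]
  | cons a M ih =>
    have : a.card ^ 2 ≤ n ^ 2 := Nat.pow_le_pow_left (by simpa using Finset.card_le_univ a) 2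
    rw [sqNorm_cons, List.length_cons, add_mul, one_mul]
    omega

lemma sq_card_drop (B A : Finset (Fin n)) :
    ((dropLower B A).card ^ 2 + (dropUpper B A).card ^ 2 : ℤ) =
      B.card ^ 2 + A.card ^ 2 +
        2 * (unmatchedUpper B A).card * (B.card - (dropUpper B A).card) := by
  have h1 := card_dropLower B A
  have h2 := card_dropUpper B A
  zify at h1 h2
  rw [h1, ← h2]
  ring

/-- The correction term in `sq_card_drop` is nonnegative because the balls left above are matched to
distinct balls of `B`. -/
lemma sq_card_le_drop (B A : Finset (Fin n)) :
    B.card ^ 2 + A.card ^ 2 ≤ (dropLower B A).card ^ 2 + (dropUpper B A).card ^ 2 := by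
  have h := sq_card_drop B A
  have h1 : ((dropUpper B A).card : ℤ) ≤ B.card := by exact_mod_cast card_dropUpper_le B A
  zify
  rw [h]
  have : (0 : ℤ) ≤ 2 * (unmatchedUpper B A).card * (B.card - (dropUpper B A).card) :=
    mul_nonneg (by positivity) (by omega)
  omega

lemma sqNorm_le_dropRow (i : ℕ) (M : BallArray n) : sqNorm M ≤ sqNorm (dropRow i M) := by
  induction i generalizing M with
  | zero =>
    match M with
    | [] => exact le_rfl
    | [a] => exact le_rfl
    | a :: b :: M =>
      have := sq_card_le_drop a b
      simp only [dropRow_zero_cons_cons, sqNorm_cons]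
      omega
  | succ i ih =>
    match M with
    | [] => exact le_rfl
    | a :: M => simpa using ih M

lemma sqNorm_le_collapse (M : BallArray n) : sqNorm M ≤ sqNorm (collapse M) :=
  collapse_induction (P := fun X => sqNorm M ≤ sqNorm X) M
    (fun i X h => h.trans (sqNorm_le_dropRow i X)) le_rfl


/-! ### Cyclic parking -/

/-- The number of steps to the right from `c` to `x` on the cycle of columns. -/
def cyclicDist (c x : Fin n) : ℕ := if c ≤ x then x - c else x + n - c

lemma cyclicDist_lt (c x : Fin n) : cyclicDist c x < n := by
  unfold cyclicDist
  have := c.2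
  have := x.2
  simp only [Fin.le_def]
  split_ifs <;> omega

lemma cyclicDist_inj {c x y : Fin n} (h : cyclicDist c x = cyclicDist c y) : x = y := by
  unfold cyclicDist at h
  have := c.2
  have := x.2
  have := y.2
  simp only [Fin.le_def] at h
  ext
  split_ifs at h <;> omega

/-- The first element of `X` weakly to the right of `c`, cyclically. -/
def firstFrom (X : Finset (Fin n)) (c : Fin n) : Option (Fin n) :=
  ((List.finRange n).rotate c.val).find? fun d => d ∈ X

lemma getElem_rotate_finRange (c : Fin n) (k : ℕ) (hk : k < ((List.finRange n).rotate c).length) :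
    cyclicDist c ((List.finRange n).rotate c)[k] = k := by
  have hk' : k < n := by simpa using hk
  have hc := c.2
  rw [List.getElem_rotate]
  unfold cyclicDist
  simp only [Fin.le_def, List.length_finRange, List.getElem_finRange, Fin.val_cast]
  rcases Nat.lt_or_ge (k + c) n with h | h
  · rw [Nat.mod_eq_of_lt h]
    split_ifs <;> omega
  · rw [Nat.mod_eq_sub_mod h, Nat.mod_eq_of_lt (by omega)]
    split_ifs <;> omega

lemma firstFrom_eq_some_iff {X : Finset (Fin n)} {c d : Fin n} :
    firstFrom X c = some d ↔ d ∈ X ∧ ∀ x ∈ X, cyclicDist c d ≤ cyclicDist c x := by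
  have hget : ∀ x : Fin n, ∃ hk : cyclicDist c x < ((List.finRange n).rotate c).length,
      ((List.finRange n).rotate c)[cyclicDist c x] = x := fun x =>
    ⟨by simpa using cyclicDist_lt c x, cyclicDist_inj (getElem_rotate_finRange c _ _)⟩
  rw [firstFrom, List.find?_eq_some_iff_getElem]
  simp only [decide_eq_true_eq]
  refine and_congr_right fun hd => ⟨?_, fun h => ?_⟩
  · rintro ⟨i, hi, rfl, h⟩ x hx
    rw [getElem_rotate_finRange]
    by_contra hlt
    obtain ⟨hk, e⟩ := hget x
    have := h _ (not_le.1 hlt)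
    simp [e, hx] at this
  · obtain ⟨hk, e⟩ := hget d
    refine ⟨_, hk, e, fun j hj => ?_⟩
    have hj' : j < ((List.finRange n).rotate c).length := hj.trans hk
    have h2 := getElem_rotate_finRange c j hj'
    simp only [Bool.not_eq_eq_eq_not, Bool.not_true, decide_eq_false_iff_not]
    intro hc
    have := h _ hc
    rw [h2] at this
    omega

lemma firstFrom_eq_none_iff {X : Finset (Fin n)} {c : Fin n} : firstFrom X c = none ↔ X = ∅ := by
  simp [firstFrom, Finset.eq_empty_iff_forall_notMem]

lemma exists_firstFrom {X : Finset (Fin n)} (h : X.Nonempty) (c : Fin n) :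
    ∃ d, firstFrom X c = some d := by
  rw [← Option.ne_none_iff_exists', Ne, firstFrom_eq_none_iff]
  exact h.ne_empty

/-- A car arriving at `c` occupies the first free element of `B` weakly to its right, where `F` is
the set of occupied elements. -/
def park (B F : Finset (Fin n)) (c : Fin n) : Finset (Fin n) :=
  match firstFrom (B \ F) c with
  | some d => insert d F
  | none => F

lemma park_eq_insert {B F : Finset (Fin n)} {c d : Fin n} (h : firstFrom (B \ F) c = some d) :
    park B F c = insert d F := by simp [park, h]

lemma park_eq_self {B F : Finset (Fin n)} {c : Fin n} (h : B \ F = ∅) : park B F c = F := by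
  simp [park, firstFrom_eq_none_iff.2 h]

lemma firstFrom_erase_of_ne {X : Finset (Fin n)} {c d e : Fin n} (h : firstFrom X c = some d)
    (hne : d ≠ e) : firstFrom (X.erase e) c = some d := by
  rw [firstFrom_eq_some_iff] at h ⊢
  exact ⟨Finset.mem_erase.2 ⟨hne, h.1⟩, fun x hx => h.2 x (Finset.mem_of_mem_erase hx)⟩

/-- The arcs from `c` and from `c'` to `d` meet `X` only in `d`, so without `d` both searches
continue from there. -/
lemma firstFrom_erase_congr {X : Finset (Fin n)} {c c' d : Fin n} (h : firstFrom X c = some d)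
    (h' : firstFrom X c' = some d) : firstFrom (X.erase d) c = firstFrom (X.erase d) c' := by
  rcases (X.erase d).eq_empty_or_nonempty with h0 | h0
  · rw [firstFrom_eq_none_iff.2 h0, firstFrom_eq_none_iff.2 h0]
  · obtain ⟨e, he⟩ := exists_firstFrom h0 c
    rw [he]
    symm
    rw [firstFrom_eq_some_iff] at *
    refine ⟨he.1, fun x hx => ?_⟩
    have h1 := h.2 x (Finset.mem_of_mem_erase hx)
    have h2 := h.2 e (Finset.mem_of_mem_erase he.1)
    have h3 := h'.2 x (Finset.mem_of_mem_erase hx)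
    have h4 := h'.2 e (Finset.mem_of_mem_erase he.1)
    have h5 := he.2 x hx
    have n1 : (x : ℕ) ≠ d := fun h => Finset.ne_of_mem_erase hx (Fin.ext h)
    have n2 : (e : ℕ) ≠ d := fun h => Finset.ne_of_mem_erase he.1 (Fin.ext h)
    have := c.2
    have := c'.2
    have := d.2
    have := e.2
    have := x.2
    unfold cyclicDist at *
    simp only [Fin.le_def] at *
    clear h h' he
    grind

lemma sdiff_insert_eq_erase (B F : Finset (Fin n)) (d : Fin n) :
    B \ insert d F = (B \ F).erase d := by
  ext x
  simp only [Finset.mem_sdiff, Finset.mem_insert, Finset.mem_erase]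
  tauto

/-- Two cars aim at different places, or at the same one, and then the second goes on to the same
next place whichever it is. So the occupied set does not depend on the order of arrival. -/
instance park_rightCommutative (B : Finset (Fin n)) : RightCommutative (park B) where
  right_comm F c c' := by
    rcases (B \ F).eq_empty_or_nonempty with h0 | h0
    · rw [park_eq_self h0, park_eq_self h0, park_eq_self h0]
    · obtain ⟨d, hd⟩ := exists_firstFrom h0 c
      obtain ⟨d', hd'⟩ := exists_firstFrom h0 c'
      rw [park_eq_insert hd, park_eq_insert hd']
      by_cases hne : d = d'
      · subst hne
        simp only [park, sdiff_insert_eq_erase]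
        rw [firstFrom_erase_congr hd hd']
      · rw [park_eq_insert (d := d'), park_eq_insert (d := d), Finset.insert_comm]
        · rw [sdiff_insert_eq_erase]; exact firstFrom_erase_of_ne hd hne
        · rw [sdiff_insert_eq_erase]; exact firstFrom_erase_of_ne hd' (Ne.symm hne)

/-- The set of balls of the lower row `B` that are paired, cyclically, to the balls of `A`. -/
noncomputable def parked (B A : Finset (Fin n)) : Finset (Fin n) := A.toList.foldl (park B) ∅

lemma foldl_park_eq_parked (B : Finset (Fin n)) {l : List (Fin n)} (hl : l.Nodup) :
    l.foldl (park B) ∅ = parked B l.toFinset :=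
  (List.toFinset_toList hl).symm.foldl_eq _

/-! ### The flow of parking cars. -/

lemma ht_singleton (x : Fin n) (t : ℕ) : ht {x} t = if n ≤ x + t then 1 else 0 := by
  have := x.2
  induction t with
  | zero => simp
  | succ t ih =>
    rw [ht_succ, ih]
    simp only [ind, Finset.mem_singleton, exists_eq_left]
    split_ifs <;> omega

lemma ht_insert {x : Fin n} {F : Finset (Fin n)} (h : x ∉ F) (t : ℕ) :
    ht (insert x F) t = ht {x} t + ht F t := by
  rw [Finset.insert_eq, ht_union_of_disjoint (Finset.disjoint_singleton_left.2 h)]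

/-- The number of entries of the list `l` in the last `t` columns. -/
def listHt (l : List (Fin n)) (t : ℕ) : ℤ := (l.map fun x => ht {x} t).sum

lemma listHt_eq {l : List (Fin n)} (hl : l.Nodup) (t : ℕ) : listHt l t = ht l.toFinset t := by
  induction l with
  | nil => simp [listHt, ht, ind]
  | cons a l ih =>
    rw [List.nodup_cons] at hl
    rw [List.toFinset_cons, ht_insert (by simpa using hl.1), ← ih hl.2]
    simp [listHt]

/-- The number `φ t` of cars that enter the last `t` columns from the left is a flow that vanishes
at all free places. -/
lemma exists_flow_foldl (B : Finset (Fin n)) (l : List (Fin n)) (hl : l.length ≤ B.card) :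
    l.foldl (park B) ∅ ⊆ B ∧ (l.foldl (park B) ∅).card = l.length ∧
    ∃ φ : ℕ → ℤ, (∀ t, 0 ≤ φ t) ∧
      (∀ t, ht (l.foldl (park B) ∅) t = listHt l t + φ t - φ 0) ∧
      ∀ x ∈ B \ l.foldl (park B) ∅, x ∉ l ∧ φ x.rev = 0 ∧ φ (x.rev + 1) = 0 := by
  induction l using List.reverseRecOn with
  | nil => exact ⟨by simp, by simp, fun _ => 0, by simp, by simp [listHt, ht, ind], by simp⟩
  | append_singleton l a ih =>
    rw [List.length_append, List.length_singleton] at hl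
    obtain ⟨h1, h2, φ, h3, h4, h5⟩ := ih (by omega)
    rw [List.foldl_append, List.foldl_cons, List.foldl_nil]
    set F := l.foldl (park B) ∅
    have hne : (B \ F).Nonempty := by
      rw [← Finset.card_pos, Finset.card_sdiff_of_subset h1]
      omega
    obtain ⟨d, hd⟩ := exists_firstFrom hne a
    rw [park_eq_insert hd]
    obtain ⟨hdF, hmin⟩ := firstFrom_eq_some_iff.1 hd
    have hdF' := Finset.mem_sdiff.1 hdF
    -- The car going from `a` to `d` adds one at each boundary that it crosses; the summand for `d <
    -- a` accounts for wrapping around.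
    refine ⟨Finset.insert_subset hdF'.1 h1, ?_, fun t => φ t + (ht {d} t - ht {a} t +
      if d < a then 1 else 0), fun t => ?_, fun t => ?_, fun x hx => ?_⟩
    · rw [Finset.card_insert_of_notMem hdF'.2, h2]; simp
    · have := h3 t
      simp only [ht_singleton, Fin.lt_def]
      split_ifs <;> omega
    · rw [ht_insert hdF'.2, h4]
      simp only [listHt, List.map_append, List.sum_append, List.map_singleton,
        List.sum_singleton, ht_zero]
      ring
    · have hx' : x ∈ B \ F ∧ x ≠ d := by
        simp only [Finset.mem_sdiff, Finset.mem_insert, not_or] at hx ⊢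
        tauto
      obtain ⟨g1, g2, g3⟩ := h5 x hx'.1
      have hm := hmin x hx'.1
      have hxd : (x : ℕ) ≠ d := fun h => hx'.2 (Fin.ext h)
      have := x.2
      have := a.2
      have := d.2
      unfold cyclicDist at hm
      simp only [Fin.le_def] at hm
      simp only [ht_singleton, Fin.lt_def, g2, g3]
      simp only [Fin.val_rev]
      refine ⟨?_, ?_, ?_⟩
      · rw [List.mem_append, List.mem_singleton, not_or]
        refine ⟨g1, fun h => ?_⟩
        rw [Fin.ext_iff] at h
        split_ifs at hm <;> omega
      · split_ifs at hm ⊢ <;> omega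
      · split_ifs at hm ⊢ <;> omega

lemma foldl_park_subset (B : Finset (Fin n)) (l : List (Fin n)) : l.foldl (park B) ∅ ⊆ B := by
  induction l using List.reverseRecOn with
  | nil => simp
  | append_singleton l a ih =>
    rw [List.foldl_append, List.foldl_cons, List.foldl_nil]
    rcases (B \ l.foldl (park B) ∅).eq_empty_or_nonempty with h0 | h0
    · rwa [park_eq_self h0]
    · obtain ⟨d, hd⟩ := exists_firstFrom h0 a
      rw [park_eq_insert hd]
      exact Finset.insert_subset (Finset.mem_sdiff.1 (firstFrom_eq_some_iff.1 hd).1).1 ih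

lemma parked_subset (B A : Finset (Fin n)) : parked B A ⊆ B := foldl_park_subset _ _

lemma card_parked {A B : Finset (Fin n)} (h : A.card ≤ B.card) : (parked B A).card = A.card := by
  rw [parked, (exists_flow_foldl B A.toList (by simpa using h)).2.1, Finset.length_toList]

lemma exists_flow {A B : Finset (Fin n)} (h : A.card ≤ B.card) :
    ∃ φ : ℕ → ℤ, (∀ t, 0 ≤ φ t) ∧ (∀ t, ht (parked B A) t = ht A t + φ t - φ 0) ∧
      ∀ x ∈ B \ parked B A, x ∉ A ∧ φ x.rev = 0 ∧ φ (x.rev + 1) = 0 := by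
  obtain ⟨-, -, φ, h1, h2, h3⟩ := exists_flow_foldl B A.toList (by simpa using h)
  refine ⟨φ, h1, fun t => ?_, fun x hx => ?_⟩
  · rw [parked, h2, listHt_eq (Finset.nodup_toList A), Finset.toList_toFinset]
  · simpa using h3 x hx

lemma disjoint_sdiff_parked {A B : Finset (Fin n)} (h : A.card ≤ B.card) :
    Disjoint A (B \ parked B A) := by
  obtain ⟨φ, -, -, h3⟩ := exists_flow h
  exact Finset.disjoint_right.2 fun x hx => (h3 x hx).1

lemma ht_pos {X : Finset (Fin n)} {x : Fin n} (hx : x ∈ X) {t : ℕ} (h : (x.rev : ℕ) < t) :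
    0 < ht X t := by
  have h1 := ht_mono X (Nat.succ_le_of_lt h)
  rw [Nat.succ_eq_add_one, ht_succ, ind_rev, if_pos hx] at h1
  have := ht_nonneg X x.rev
  omega

lemma exists_last_mem {X : Finset (Fin n)} {t : ℕ} (h : 0 < ht X t) :
    ∃ x ∈ X, (x.rev : ℕ) + 1 ≤ t ∧ ht X (x.rev + 1) = ht X t := by
  induction t with
  | zero => simp at h
  | succ t ih =>
    by_cases h0 : ind X t = 0
    · have e : ht X (t + 1) = ht X t := by rw [ht_succ, h0, add_zero]
      obtain ⟨x, h1, h2, h3⟩ := ih (by omega)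
      exact ⟨x, h1, by omega, by omega⟩
    · induction t using ind_cases (n := n) with
      | h1 x => exact ⟨x, by by_contra hx; exact h0 (by rw [ind_rev, if_neg hx]), le_rfl, rfl⟩
      | h2 t ht' => exact absurd (ind_of_le X ht') h0

lemma exists_first_mem {X : Finset (Fin n)} {t : ℕ} (h : 0 < ht X t) :
    ∃ x ∈ X, (x.rev : ℕ) < t ∧ ht X x.rev = 0 := by
  induction t with
  | zero => simp at h
  | succ t ih =>
    rcases (ht_nonneg X t).lt_or_eq with h0 | h0
    · obtain ⟨x, h1, h2, h3⟩ := ih h0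
      exact ⟨x, h1, by omega, h3⟩
    · rw [ht_succ] at h
      induction t using ind_cases (n := n) with
      | h1 x => exact ⟨x, by by_contra hx; rw [ind_rev, if_neg hx] at h; omega, by omega, h0.symm⟩
      | h2 t ht' => rw [ind_of_le X ht'] at h; omega

lemma runMax_congr {d e : ℕ → ℤ} {t : ℕ} (h : ∀ s ≤ t, d s = e s) : runMax d t = runMax e t := by
  rw [runMax_eq_iff]
  obtain ⟨s, hs, he⟩ := exists_runMax_eq e t
  exact ⟨fun s hs => h s hs ▸ le_runMax e hs, s, hs, (h s hs).trans he.symm⟩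

/-- Moving up the balls of the lower row `B` that are not cyclically paired to `A` does not change
the result of dropping. -/
lemma unmatchedUpper_parked {A B : Finset (Fin n)} (h : A.card ≤ B.card) :
    unmatchedUpper (parked B A) (A ∪ (B \ parked B A)) =
      unmatchedUpper B A ∪ (B \ parked B A) := by
  have hd := disjoint_sdiff_parked h
  obtain ⟨φ, h1, h2, h3⟩ := exists_flow h
  have hb : ∀ t, ht B t = ht (parked B A) t + ht (B \ parked B A) t := fun t => by
    rw [ht_sdiff (parked_subset B A)]; ring
  apply eq_of_ht_eq
  intro t
  rw [ht_union_of_disjoint (Finset.disjoint_of_subset_left (unmatchedUpper_subset B A) hd),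
    ht_unmatchedUpper, ht_unmatchedUpper]
  set X := B \ parked B A
  simp only [ht_union_of_disjoint hd, hb, h2]
  -- The flow vanishes beside free places. If there are any in the last `t` columns, the maximum for
  -- `B` is `φ 0`, attained just right of the rightmost one, and the maximum after lifting is `ht X
  -- t + φ 0`, attained just left of the leftmost one.
  rcases (ht_nonneg X t).lt_or_eq with h0 | h0
  · obtain ⟨x, hx, hxt, hx'⟩ := exists_last_mem h0
    obtain ⟨y, hy, hyt, hy'⟩ := exists_first_mem h0
    have e1 := (h3 x hx).2.2
    have e2 := (h3 y hy).2.1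
    have : runMax (fun s => ht A s - (ht A s + φ s - φ 0 + ht X s)) t = φ 0 := by
      rw [runMax_eq_iff]
      refine ⟨fun s _ => ?_, y.rev, hyt.le, by omega⟩
      have := h1 s
      have := ht_nonneg X s
      omega
    rw [this, runMax_eq_iff]
    refine ⟨fun s hs => ?_, x.rev + 1, hxt, by omega⟩
    have := h1 s
    have := ht_mono X hs
    omega
  · rw [← h0, add_zero]
    apply runMax_congr
    intro s hs
    have := ht_mono X hs
    have := ht_nonneg X s
    omega

lemma dropLower_parked {A B : Finset (Fin n)} (h : A.card ≤ B.card) :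
    dropLower (parked B A) (A ∪ (B \ parked B A)) = dropLower B A := by
  rw [dropLower, dropLower, unmatchedUpper_parked h, Finset.union_comm (unmatchedUpper B A),
    ← Finset.union_assoc, Finset.union_sdiff_of_subset (parked_subset B A)]

lemma dropUpper_parked {A B : Finset (Fin n)} (h : A.card ≤ B.card) :
    dropUpper (parked B A) (A ∪ (B \ parked B A)) = dropUpper B A := by
  rw [dropUpper, dropUpper, unmatchedUpper_parked h]
  have hd := Finset.disjoint_left.1 (disjoint_sdiff_parked h)
  ext x
  have := @hd x
  simp only [Finset.mem_sdiff, Finset.mem_union] at *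
  tauto

/-- Domination excludes wrapping: right of the rightmost free place all of `B` is occupied and no
flow leaves, which forces `φ 0 = 0`. Without free places the height difference serves as flow. -/
lemma Dominates.exists_flow {A B : Finset (Fin n)} (h : Dominates B A) :
    ∃ φ : ℕ → ℤ, (∀ t, 0 ≤ φ t) ∧ (∀ t, ht (parked B A) t = ht A t + φ t) ∧
      ∀ x ∈ B \ parked B A, φ x.rev = 0 ∧ φ (x.rev + 1) = 0 := by
  obtain ⟨φ, h1, h2, h3⟩ := MultilineQueue.exists_flow h.card_le
  rcases (B \ parked B A).eq_empty_or_nonempty with h0 | ⟨x, hx⟩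
  · have e : parked B A = B :=
      (parked_subset B A).antisymm (Finset.sdiff_eq_empty_iff_subset.1 h0)
    rw [h0, e]
    exact ⟨fun t => ht B t - ht A t, fun t => sub_nonneg.2 (h t), fun t => by ring, by simp⟩
  · obtain ⟨y, hy, hyt, hy'⟩ := exists_first_mem (ht_pos hx x.rev.2)
    have e1 := ht_sdiff (parked_subset B A) y.rev
    have e2 := h y.rev
    have e3 := h2 y.rev
    have e4 := (h3 y hy).2.1
    have e5 := h1 0
    have e6 : φ 0 = 0 := by omega
    exact ⟨φ, h1, fun t => by rw [h2, e6, sub_zero], fun z hz => (h3 z hz).2⟩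

lemma Dominates.ht_le_parked {A B : Finset (Fin n)} (h : Dominates B A) (t : ℕ) :
    ht A t ≤ ht (parked B A) t := by
  obtain ⟨φ, h1, h2, -⟩ := h.exists_flow
  have := h1 t
  rw [h2]; omega

/-- A dropped ball is not paired after dropping; moreover no ball to its right is both unpaired
after dropping and already present before. -/
lemma unmatchedUpper_drop_structure (S U : Finset (Fin n)) :
    ∀ i ∈ unmatchedUpper S U, i ∉ parked (dropLower S U) (dropUpper S U) ∧
      ∀ j, i < j → j ∈ S → j ∈ parked (dropLower S U) (dropUpper S U) := by
  have hdom := dominates_drop S U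
  have hc := card_parked hdom.card_le
  have hsub := parked_subset (dropLower S U) (dropUpper S U)
  obtain ⟨φ, h1, h2, h3⟩ := hdom.exists_flow
  have hr := ht_dropLower S U
  have hz := ht_dropUpper S U
  have hx := ht_sdiff hsub
  have hD := ht_unmatchedUpper S U
  have hDR : unmatchedUpper S U ⊆ dropLower S U := Finset.subset_union_right
  have hSD := disjoint_unmatchedUpper S U
  have hS : S ⊆ dropLower S U := Finset.subset_union_left
  have hDZ : ∀ i ∈ unmatchedUpper S U, i ∉ dropUpper S U :=
    fun i hi h => (Finset.mem_sdiff.1 h).2 hi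
  generalize hδ : runMax (fun s => ht U s - ht S s) = δ at *
  set R := dropLower S U
  set Z := dropUpper S U
  set G := parked R Z
  set D := unmatchedUpper S U
  have hle : ∀ s t, s ≤ t → ht U s - ht S s ≤ δ t := by
    intro s t h
    have := le_runMax (fun s => ht U s - ht S s) h
    rw [hδ] at this
    exact this
  have hsuc : ∀ t, δ (t + 1) = max (δ t) (ht U (t + 1) - ht S (t + 1)) := by
    intro t; rw [← hδ]; rfl
  have hφn : φ n = 0 := by
    have h := h2 n
    rw [ht_card, ht_card, hc] at h
    omega
  -- If a dropped ball `i` were paired, the flow just left of it would be positive. Further left,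
  -- `ht R - ht Z` never falls below its value there, and positive flow leaves no free place; so the
  -- flow stays positive up to the left edge, against `hφn`.
  have hDG : ∀ i ∈ D, i ∉ G := by
    intro i hi
    have hi1 : δ (i.rev + 1) = δ i.rev + 1 := by
      rw [← hD, ← hD, ht_succ, ind_rev, if_pos hi]
    have hi2 := hsuc i.rev
    have hi3 : ht R (i.rev + 1) = ht R i.rev + 1 := by
      rw [ht_succ, ind_rev, if_pos (hDR hi)]
    have hi4 : ht Z (i.rev + 1) = ht Z i.rev := by
      rw [ht_succ, ind_rev, if_neg (hDZ i hi), add_zero]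
    have hδmono : ∀ t, (i.rev : ℕ) + 1 ≤ t → δ (i.rev + 1) ≤ δ t := fun t h => by
      rw [← hD, ← hD]; exact ht_mono D h
    intro hiG
    have key : ∀ t, (i.rev : ℕ) + 1 ≤ t → 1 ≤ φ t ∧ ht (R \ G) t = ht (R \ G) (i.rev + 1) := by
      intro t ht'
      have b1 := hx i.rev
      have b2 := hx (i.rev + 1)
      have b3 : ht (R \ G) (i.rev + 1) = ht (R \ G) i.rev := by
        rw [ht_succ, ind_rev, if_neg (by simp [hiG]), add_zero]
      have b4 := h2 i.rev
      have b5 := h2 (i.rev + 1)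
      have b6 := h1 i.rev
      induction t, ht' using Nat.le_induction with
      | base => exact ⟨by omega, rfl⟩
      | succ t ht' ih =>
        have c1 : ht (R \ G) (t + 1) = ht (R \ G) t := by
          rw [ht_succ]
          induction t using ind_cases (n := n) with
          | h1 x =>
            rw [ind_rev, if_neg, add_zero]
            intro hxX
            have := (h3 x hxX).1
            omega
          | h2 t h => rw [ind_of_le _ h, add_zero]
        refine ⟨?_, c1.trans ih.2⟩
        have c2 := hle (t + 1) (t + 1) le_rfl
        have c3 := hδmono (t + 1) (by omega)
        have c4 := hr (t + 1)
        have c5 := hz (t + 1)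
        have c6 := hr (i.rev + 1)
        have c7 := hz (i.rev + 1)
        have c8 := hx (t + 1)
        have c9 := h2 (t + 1)
        omega
    have := (key n i.rev.2).1
    omega
  refine fun i hi => ⟨hDG i hi, fun j hij hjS => ?_⟩
  by_contra hjG
  -- No flow enters at the free place `i`, so the free places from `i` rightwards number `ht R - ht
  -- Z`, which equals `ht D` there. They are exactly the dropped balls, leaving no room for `j`.
  have a1 := (h3 i (Finset.mem_sdiff.2 ⟨hDR hi, hDG i hi⟩)).2
  have a2 := hx (i.rev + 1)
  have a3 := h2 (i.rev + 1)
  have a4 := hr (i.rev + 1)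
  have a5 := hz (i.rev + 1)
  have hDX : D ⊆ R \ G := fun x hx => Finset.mem_sdiff.2 ⟨hDR hx, hDG x hx⟩
  have a6 := ht_sdiff hDX (i.rev + 1)
  have a7 := hD (i.rev + 1)
  have b1 : δ (i.rev + 1) = δ i.rev + 1 := by
    rw [← hD, ← hD, ht_succ, ind_rev, if_pos hi]
  have b2 := hsuc i.rev
  have hj : j ∈ (R \ G) \ D := by
    have := Finset.disjoint_left.1 hSD hjS
    simp only [Finset.mem_sdiff]
    exact ⟨⟨hS hjS, hjG⟩, this⟩
  have a8 := ht_pos hj (t := i.rev + 1) (by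
    simp only [Fin.val_rev, Fin.lt_def] at hij ⊢
    omega)
  omega


/-! ### The key of an array -/

/-- The balls of the bottom row that are reached from row `k + 1` by pairing downwards. -/
noncomputable def key : BallArray n → ℕ → Finset (Fin n)
  | [], _ => ∅
  | B :: _, 0 => B
  | B :: M, k + 1 => parked B (key M k)

lemma key_cons_subset (B : Finset (Fin n)) (M : BallArray n) (k : ℕ) : key (B :: M) k ⊆ B := by
  cases k with
  | zero => exact subset_rfl
  | succ k => exact parked_subset _ _

lemma card_key_le {M : BallArray n} {m : ℕ} (h : ∀ X ∈ M, X.card ≤ m) (k : ℕ) :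
    (key M k).card ≤ m := by
  match M, h with
  | [], _ => simp [key]
  | B :: M, h => exact (Finset.card_le_card (key_cons_subset B M k)).trans (h B (by simp))

lemma Nonwrapping.dominates_key {B : Finset (Fin n)} {M : BallArray n}
    (h : Nonwrapping (B :: M)) (k : ℕ) : Dominates B (key M k) := by
  match M, h with
  | [], _ => exact dominates_of_subset (by simp [key])
  | C :: M, h =>
    exact (List.isChain_cons_cons.1 h).1.trans (dominates_of_subset (key_cons_subset C M k))

/-- This move exchanges the sizes of the two bottom rows, hence keeps `sqNorm`. -/
lemma collapse_parked {A B : Finset (Fin n)} (h : A.card ≤ B.card) (M : BallArray n) :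
    collapse (parked B A :: (A ∪ (B \ parked B A)) :: M) = collapse (B :: A :: M) := by
  rw [← collapse_cons_cons, dropLower_parked h, dropUpper_parked h, collapse_cons_cons]

lemma card_union_sdiff_parked {A B : Finset (Fin n)} (h : A.card ≤ B.card) :
    (A ∪ (B \ parked B A)).card = B.card := by
  rw [Finset.card_union_of_disjoint (disjoint_sdiff_parked h),
    Finset.card_sdiff_of_subset (parked_subset B A), card_parked h]
  omega

/-- Row `q + 1` can be moved to the bottom without changing the result of collapsing. -/
lemma exists_key_array {C : BallArray n} (hC : Descending C) {q : ℕ} (hq : q < C.length) :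
    ∃ rest, collapse (key C q :: rest) = collapse C ∧
      sqNorm (key C q :: rest) = sqNorm C ∧ (key C q :: rest).length = C.length := by
  induction q generalizing C with
  | zero =>
    match C, hq with
    | B :: M, _ => exact ⟨M, rfl, rfl, rfl⟩
  | succ q ih =>
    match C, hC, hq with
    | B :: M, hC, hq =>
      obtain ⟨hB, hM⟩ := List.pairwise_cons.1 hC
      obtain ⟨rest, h1, h2, h3⟩ := ih hM (by simpa using hq)
      have hle : (key M q).card ≤ B.card := card_key_le hB q
      refine ⟨(key M q ∪ (B \ parked B (key M q))) :: rest, ?_, ?_, ?_⟩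
      · rw [key, collapse_parked hle]
        exact collapse_cons_congr B h1
      · rw [sqNorm_cons] at h2
        rw [key, sqNorm_cons, sqNorm_cons, sqNorm_cons, card_parked hle,
          card_union_sdiff_parked hle]
        omega
      · rw [List.length_cons] at h3
        rw [List.length_cons, List.length_cons, List.length_cons, ← h3]

/-! ### Ends of strings -/

/-- Either all balls of the upper row `U` or all balls of the lower row `S` are matched. -/
def Settled (S U : Finset (Fin n)) : Prop :=
  ∀ t, ht U t - ht S t ≤ max 0 ((U.card : ℤ) - S.card)

lemma Settled.card_unmatchedUpper_le {S U : Finset (Fin n)} (h : Settled S U) :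
    ((unmatchedUpper S U).card : ℤ) ≤ max 0 ((U.card : ℤ) - S.card) := by
  rw [← ht_card, ht_unmatchedUpper]
  exact runMax_le _ fun s _ => h s

/-- Balls drop although some ball of `S` stays unmatched; this makes the square norm grow strictly.
-/
lemma card_unmatchedUpper_of_not_settled {S U : Finset (Fin n)} (h : ¬ Settled S U) :
    0 < (unmatchedUpper S U).card ∧ (dropUpper S U).card < S.card := by
  unfold Settled at h
  push Not at h
  obtain ⟨t, h⟩ := h
  have h1 := card_dropUpper S U
  have h2 : t ≤ n := by
    by_contra hn
    rw [ht_of_le _ (by omega), ht_of_le _ (by omega)] at h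
    omega
  have h3 := le_runMax (fun s => ht U s - ht S s) h2
  rw [← ht_unmatchedUpper, ht_card] at h3
  omega

lemma sq_card_lt_drop {S U : Finset (Fin n)} (h : ¬ Settled S U) :
    S.card ^ 2 + U.card ^ 2 < (dropLower S U).card ^ 2 + (dropUpper S U).card ^ 2 := by
  obtain ⟨h1, h2⟩ := card_unmatchedUpper_of_not_settled h
  have h3 := sq_card_drop S U
  have : (0 : ℤ) < 2 * (unmatchedUpper S U).card * (S.card - (dropUpper S U).card) :=
    mul_pos (by omega) (by omega)
  zify
  rw [h3]
  omega

/-- Let `s ≤ t` be where the running maximum is attained. From `s` to `t` the parked copy of `Y`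
gains no more than `C`, so the hypothesis at `s` bounds the excess at `t`. -/
lemma Settled.dropUpper {S C Y : Finset (Fin n)} (hY : Dominates C Y)
    (h : Settled S (parked C Y)) : Settled (dropUpper S C) Y := by
  intro t
  have h1 := card_dropUpper_le S C
  have h2 := hY.ht_le_parked t
  obtain ⟨s, hs, e⟩ := exists_runMax_eq (fun s => ht C s - ht S s) t
  have h3 := ht_sub_le_of_subset (parked_subset C Y) hs
  have h4 := h s
  rw [card_parked hY.card_le] at h4
  rw [ht_dropUpper, e]
  omega

lemma Dominates.dominates_dropLower {C X : Finset (Fin n)} (h : Dominates C X)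
    (S : Finset (Fin n)) : Dominates (dropLower S C) (dropLower (dropUpper S C) X) := by
  intro t
  rw [ht_dropLower, ht_dropLower]
  obtain ⟨s, hs, e⟩ := exists_runMax_eq (fun s => ht X s - ht (MultilineQueue.dropUpper S C) s) t
  rw [e]
  have h1 := h s
  have h2 := runMax_mono (fun s => ht C s - ht S s) hs
  have h3 := le_runMax (fun s => ht C s - ht S s) (le_refl t)
  have h4 := ht_dropUpper S C s
  have h5 := ht_dropUpper S C t
  omega

/-- Inserting a row below a nonwrapping array. -/
lemma collapse_cons_of_nonwrapping {C : Finset (Fin n)} {M : BallArray n}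
    (h : Nonwrapping (C :: M)) (S : Finset (Fin n)) :
    collapse (S :: C :: M) = dropLower S C :: collapse (dropUpper S C :: M) := by
  suffices Nonwrapping (dropLower S C :: collapse (dropUpper S C :: M)) by
    rw [← this.collapse_eq, collapse_cons_collapse, collapse_cons_cons]
  induction M generalizing S C with
  | nil =>
    rw [Nonwrapping.collapse_eq (M := [dropUpper S C]) (List.IsChain.singleton _)]
    exact List.IsChain.cons_cons (dominates_drop S C) (List.IsChain.singleton _)
  | cons X M ih =>
    have hX := List.isChain_cons_cons.1 h
    have h1 := ih hX.2 (dropUpper S C)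
    have h2 : collapse (dropUpper S C :: X :: M) =
        dropLower (dropUpper S C) X :: collapse (dropUpper (dropUpper S C) X :: M) := by
      rw [← h1.collapse_eq, collapse_cons_collapse, collapse_cons_cons]
    rw [h2]
    exact List.IsChain.cons_cons (hX.1.dominates_dropLower S) h1

lemma parked_drop_subset (S U : Finset (Fin n)) :
    parked (dropLower S U) (dropUpper S U) ⊆ S := by
  intro x hx
  rcases Finset.mem_union.1 (parked_subset _ _ hx) with h | h
  · exact h
  · exact absurd hx (unmatchedUpper_drop_structure S U x h).1

/-- If `S` does not dominate the row above, being settled means that all of `S` is matched, so the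
balls left above are as many as `S`. By induction they form a key set one row higher, and they pair
down into `S`, hence onto it. -/
lemma exists_eq_key_of_settled {C : BallArray n} (hC : Nonwrapping C) (S : Finset (Fin n))
    (h : ∀ q < C.length, Settled S (key C q)) :
    ∃ k < C.length + 1, S = key (collapse (S :: C)) k := by
  induction C generalizing S with
  | nil =>
    refine ⟨0, by simp, ?_⟩
    rw [Nonwrapping.collapse_eq (M := [S]) (List.IsChain.singleton _)]
    rfl
  | cons C M ih =>
    by_cases hdom : Dominates S C
    · refine ⟨0, by simp, ?_⟩
      rw [Nonwrapping.collapse_eq (M := S :: C :: M) (List.IsChain.cons_cons hdom hC)]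
      rfl
    · have h0 := (h 0 (by simp)).card_unmatchedUpper_le
      simp only [key] at h0
      have h1 : (unmatchedUpper S C).card ≠ 0 := by
        rwa [Ne, Finset.card_eq_zero, unmatchedUpper_eq_empty_iff]
      have h2 := card_dropUpper S C
      have h3 := card_dropUpper_le S C
      obtain ⟨k, hk, e⟩ := ih (List.IsChain.of_cons hC) (dropUpper S C) fun q hq =>
        Settled.dropUpper (hC.dominates_key q) (h (q + 1) (by simpa using hq))
      refine ⟨k + 1, by simpa using hk, ?_⟩
      rw [collapse_cons_of_nonwrapping hC, key, ← e]
      refine (Finset.eq_of_subset_of_card_le (parked_drop_subset S C) ?_).symm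
      rw [card_parked (dominates_drop S C).card_le]
      omega

/-- If the bottom row of an array contains `j` but not `i < j`, then so does some set in the key of
the collapsed array. -/
theorem exists_key_collapse {i j : Fin n} (hij : i < j) (S : Finset (Fin n)) (C : BallArray n)
    (hi : i ∉ S) (hj : j ∈ S) :
    ∃ k < C.length + 1, j ∈ key (collapse (S :: C)) k ∧ i ∉ key (collapse (S :: C)) k := by
  -- `N` bounds the number of strict increases of `sqNorm` still possible, by `sqNorm_le`.
  obtain ⟨N, hN⟩ : ∃ N, (C.length + 1) * n ^ 2 + 1 ≤ sqNorm (S :: C) + N := ⟨_, le_add_self⟩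
  induction N generalizing S C with
  | zero =>
    have := sqNorm_le (S :: C)
    rw [List.length_cons] at this
    omega
  | succ N ih =>
    have hC := nonwrapping_collapse C
    have hnorm := sqNorm_le_collapse C
    by_cases hall : ∀ q < (collapse C).length, Settled S (key (collapse C) q)
    · obtain ⟨k, hk, e⟩ := exists_eq_key_of_settled hC S hall
      rw [collapse_cons_collapse] at e
      rw [length_collapse] at hk
      exact ⟨k, hk, e ▸ hj, e ▸ hi⟩
    · push Not at hall
      obtain ⟨q, hq, hns⟩ := hall
      obtain ⟨rest, h1, h2, h3⟩ := exists_key_array hC.descending hq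
      set U := key (collapse C) q
      have h4 : collapse (S :: U :: rest) = collapse (S :: C) := by
        rw [collapse_cons_congr S h1, collapse_cons_collapse]
      have h5 := sq_card_lt_drop hns
      have hdom := dominates_drop S U
      rw [length_collapse, List.length_cons] at h3
      simp only [sqNorm_cons] at hN h2
      by_cases hiR : i ∈ dropLower S U
      -- Here `i` is dropped into the bottom row; lifting the unpaired balls removes it again and
      -- keeps `j`.
      · have hiD : i ∈ unmatchedUpper S U := (Finset.mem_union.1 hiR).resolve_left hi
        obtain ⟨h6, h7⟩ := unmatchedUpper_drop_structure S U i hiD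
        have h8 := ih _ ((dropUpper S U ∪ (dropLower S U \ parked (dropLower S U)
          (dropUpper S U))) :: rest) h6 (h7 j hij hj) (by
            simp only [sqNorm_cons, List.length_cons, card_parked hdom.card_le,
              card_union_sdiff_parked hdom.card_le, h3]
            omega)
        rw [collapse_parked hdom.card_le, collapse_cons_cons, h4, List.length_cons, h3] at h8
        exact h8
      · have h8 := ih (dropLower S U) (dropUpper S U :: rest) hiR (Finset.mem_union_left _ hj) (by
          simp only [sqNorm_cons, List.length_cons, h3]
          omega)
        rw [collapse_cons_cons, h4, List.length_cons, h3] at h8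
        exact h8

/-! ### The type in terms of the key -/

/-- The columns in which `f` is at least `v`. -/
def superlevel (f : Fin n → ℕ) (v : ℕ) : Finset (Fin n) := {x | v ≤ f x}

@[simp] lemma mem_superlevel {f : Fin n → ℕ} {v : ℕ} {x : Fin n} :
    x ∈ superlevel f v ↔ v ≤ f x := by simp [superlevel]

lemma firstUnlabeled_eq (B : Finset (Fin n)) (lower : Fin n → ℕ) (c : Fin n) :
    firstUnlabeled B lower c = firstFrom (B \ superlevel lower 1) c := by
  unfold firstUnlabeled firstFrom
  congr 1
  funext d
  simp

/-- Balls with label at least `v` come first, and until then every occupied place has such a label;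
later balls only fill free places with smaller labels. -/
lemma foldl_pairBall (B : Finset (Fin n)) (l : List (Fin n × ℕ))
    (hl : l.Pairwise fun p q => q.2 ≤ p.2) (hpos : ∀ p ∈ l, 1 ≤ p.2) (v : ℕ) (hv : 1 ≤ v) :
    superlevel (l.foldl (pairBall B) fun _ => 0) v =
      ((l.filter fun p => v ≤ p.2).map Prod.fst).foldl (park B) ∅ := by
  induction l using List.reverseRecOn generalizing v with
  | nil =>
    ext x
    simp
    omega
  | append_singleton l p ih =>
    rw [List.pairwise_append] at hl
    have hp : 1 ≤ p.2 := hpos p (by simp)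
    have hpos' : ∀ p ∈ l, 1 ≤ p.2 := fun q hq => hpos q (by simp [hq])
    have ihv := ih hl.1 hpos' v hv
    have ih1 := ih hl.1 hpos' 1 le_rfl
    rw [List.foldl_append, List.foldl_cons, List.foldl_nil, List.filter_append, List.map_append,
      List.foldl_append]
    set g := l.foldl (pairBall B) (fun _ => 0)
    have hupd : ∀ d, firstUnlabeled B g p.1 = some d →
        pairBall B g p = Function.update g d p.2 := fun d hd => by simp [pairBall, hd]
    have hzero : ∀ d, firstUnlabeled B g p.1 = some d → g d = 0 := fun d hd => by
      rw [firstUnlabeled_eq] at hd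
      have := (firstFrom_eq_some_iff.1 hd).1
      simp at this
      omega
    by_cases hvp : v ≤ p.2
    · have hfil : ∀ w ≤ p.2, l.filter (fun q => w ≤ q.2) = l := fun w hw =>
        List.filter_eq_self.2 fun q hq => by
          simpa using hw.trans (hl.2.2 q hq p (by simp))
      rw [hfil v hvp] at ihv
      rw [hfil 1 hp] at ih1
      rw [hfil v hvp, ← ihv]
      simp only [hvp, decide_true, List.filter_cons_of_pos, List.filter_nil, List.map_cons,
        List.map_nil, List.foldl_cons, List.foldl_nil]
      have hfu := firstUnlabeled_eq B g p.1
      rw [ih1.trans ihv.symm] at hfu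
      unfold park
      rw [← hfu]
      rcases hd : firstUnlabeled B g p.1 with _ | d
      · simp [pairBall, hd]
      · rw [hupd d hd]
        ext x
        by_cases hx : x = d
        · subst hx; simp [hvp]
        · simp [hx]
    · have hfil : [p].filter (fun q => v ≤ q.2) = [] := by simpa using hvp
      rw [hfil]
      simp only [List.map_nil, List.foldl_nil]
      rw [← ihv]
      rcases hd : firstUnlabeled B g p.1 with _ | d
      · simp [pairBall, hd]
      · rw [hupd d hd]
        ext x
        by_cases hx : x = d
        · subst hx
          have := hzero x hd
          simp [this]
          omega
        · simp [hx]

lemma mem_pairingOrder {upper : Fin n → ℕ} {p : Fin n × ℕ} :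
    p ∈ pairingOrder upper ↔ 1 ≤ p.2 ∧ upper p.1 = p.2 := by
  obtain ⟨c, k⟩ := p
  simp only [pairingOrder, List.mem_flatMap, List.mem_reverse, List.mem_range, List.mem_map,
    List.mem_filter, List.mem_finRange, true_and, decide_eq_true_eq, Prod.mk.injEq]
  constructor
  · rintro ⟨m, hm, c', hc', rfl, rfl⟩
    exact ⟨by omega, hc'⟩
  · rintro ⟨h1, h2⟩
    have := Finset.le_sup (f := upper) (Finset.mem_univ c)
    exact ⟨k - 1, by omega, c, by omega, rfl, by omega⟩

lemma pairwise_pairingOrder (upper : Fin n → ℕ) :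
    (pairingOrder upper).Pairwise fun p q => q.2 ≤ p.2 := by
  rw [pairingOrder, List.pairwise_flatMap]
  constructor
  · intro k _
    rw [List.pairwise_map]
    exact List.pairwise_of_forall fun _ _ => le_rfl
  · rw [List.pairwise_reverse]
    refine List.pairwise_lt_range.imp ?_
    intro a b hab x hx y hy
    simp only [List.mem_map] at hx hy
    obtain ⟨_, _, rfl⟩ := hx
    obtain ⟨_, _, rfl⟩ := hy
    simp only
    omega

lemma nodup_map_fst_pairingOrder (upper : Fin n → ℕ) :
    ((pairingOrder upper).map Prod.fst).Nodup := by
  rw [pairingOrder, List.map_flatMap, List.nodup_flatMap]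
  constructor
  · intro k _
    rw [List.map_map]
    simpa [Function.comp_def] using (List.nodup_finRange n).filter _
  · rw [List.pairwise_reverse]
    refine List.pairwise_lt_range.imp ?_
    intro a b hab x hx hy
    simp only [List.map_map, Function.comp_def, List.map_id', List.mem_filter,
      decide_eq_true_eq] at hx hy
    omega

lemma le_foldl_pairingOrder (B : Finset (Fin n)) (upper : Fin n → ℕ) {v : ℕ} (hv : 1 ≤ v) :
    superlevel ((pairingOrder upper).foldl (pairBall B) fun _ => 0) v =
      parked B (superlevel upper v) := by
  rw [foldl_pairBall B _ (pairwise_pairingOrder upper) (fun p hp => (mem_pairingOrder.1 hp).1) v hv,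
    foldl_park_eq_parked B ((nodup_map_fst_pairingOrder upper).sublist
      (List.Sublist.map _ List.filter_sublist))]
  congr 1
  ext x
  simp only [List.mem_toFinset, List.mem_map, List.mem_filter, mem_pairingOrder,
    decide_eq_true_eq, mem_superlevel, Prod.exists,
    exists_and_right, exists_eq_right]
  constructor
  · rintro ⟨k, ⟨h1, h2⟩, h3⟩
    omega
  · intro h
    exact ⟨upper x, ⟨by omega, rfl⟩, h⟩

/-- List index `k` is row `r + k`. The bounds on nonzero labels carry the induction: they identify
the superlevels `1` and `r + 1` of the row above and empty those beyond the top row. -/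
lemma labels_spec (r : ℕ) (hr : 1 ≤ r) (M : BallArray n) (x : Fin n) :
    (∀ k < M.length, (r + k ≤ labels r M x ↔ x ∈ key M k)) ∧
    (1 ≤ labels r M x → r ≤ labels r M x) ∧ labels r M x < r + M.length := by
  induction M generalizing r x with
  | nil => simp [labels]; omega
  | cons B M ih =>
    have ih' := ih (r + 1) (by omega)
    have hpar := fun v hv => le_foldl_pairingOrder B (labels (r + 1) M) (v := v) hv
    rw [labels, labelRow]
    set g := (pairingOrder (labels (r + 1) M)).foldl (pairBall B) fun _ => 0
    beta_reduce
    have hmem : ∀ v, 1 ≤ v → (v ≤ g x ↔ x ∈ parked B (superlevel (labels (r + 1) M) v)) :=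
      fun v hv => by rw [← hpar v hv]; simp
    have h1 : 1 ≤ g x → r + 1 ≤ g x := by
      rw [hmem 1 le_rfl, hmem (r + 1) (by omega)]
      have : superlevel (labels (r + 1) M) 1 =
          superlevel (labels (r + 1) M) (r + 1) := by
        ext y
        rw [mem_superlevel, mem_superlevel]
        exact ⟨(ih' y).2.1, fun h => by omega⟩
      rw [this]
      exact id
    have h2 : 1 ≤ g x → x ∈ B := fun h => parked_subset _ _ ((hmem 1 le_rfl).1 h)
    have h3 : g x < r + 1 + M.length := by
      by_contra h
      rw [not_lt, hmem _ (by omega)] at h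
      have : superlevel (labels (r + 1) M) (r + 1 + M.length) = ∅ := by
        ext y
        have := (ih' y).2.2
        simp
        omega
      rw [this] at h
      simp [parked] at h
    refine ⟨fun k hk => ?_, ?_, ?_⟩
    · cases k with
      | zero =>
        rw [key]
        by_cases hx : x ∈ B <;> by_cases hg : g x = 0 <;> simp [hx, hg]
        · omega
        · omega
        · exact absurd (h2 (by omega)) hx
      | succ k =>
        have hk' : k < M.length := by simpa using hk
        have : superlevel (labels (r + 1) M) (r + 1 + k) = key M k := by
          ext y
          simp [(ih' y).1 k hk']
        have h4 := hmem (r + 1 + k) (by omega)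
        rw [this] at h4
        rw [key, ← h4]
        split_ifs <;> omega
    · split_ifs <;> omega
    · rw [List.length_cons]
      split_ifs <;> omega

lemma lt_type_iff (M : BallArray n) {k : ℕ} (hk : k < M.length) (x : Fin n) :
    k < type M x ↔ x ∈ key M k := by
  rw [← (labels_spec 1 le_rfl M x).1 k hk, type]
  omega

/-! ### Coinversions of the collapsed queue. -/

lemma IsMultilineQueue.descending {lam : YoungDiagram} {M : BallArray n}
    (hM : IsMultilineQueue lam M) : Descending M := by
  rw [Descending, List.pairwise_iff_getElem]
  intro i j hi hj hij
  rw [hM.2 i hi, hM.2 j hj]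
  exact lam.colLen_anti i j hij.le

theorem type_collapse_lt {M : BallArray n} (hM : Descending M) {i j : Fin n} (hij : i < j)
    (h : type M i < type M j) : type (collapse M) i < type (collapse M) j := by
  have hlt : type M i < M.length := by
    have := (labels_spec 1 le_rfl M j).2.2
    rw [← type] at this
    omega
  -- The key set at index `type M i` consists of the columns with label above that of `i`; it
  -- contains `j` but not `i`.
  obtain ⟨rest, h1, -, h3⟩ := exists_key_array hM hlt
  obtain ⟨k, hk, hkj, hki⟩ := exists_key_collapse hij _ rest
    (mt (lt_type_iff M hlt i).2 (lt_irrefl _)) ((lt_type_iff M hlt j).1 h)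
  rw [List.length_cons] at h3
  rw [h1] at hkj hki
  have hk' : k < (collapse M).length := by rw [length_collapse]; omega
  rw [← lt_type_iff _ hk'] at hkj hki
  omega

end MultilineQueue

theorem mainTheorem7 {n : ℕ} (lam : YoungDiagram) (M : MultilineQueue.BallArray n)
    (hM : MultilineQueue.IsMultilineQueue lam M) :
    (∀ i j : Fin n, i < j → MultilineQueue.type M i < MultilineQueue.type M j →
      MultilineQueue.type (MultilineQueue.collapse M) i <
        MultilineQueue.type (MultilineQueue.collapse M) j) ∧
    MultilineQueue.coinversions (MultilineQueue.type M) ⊆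
      MultilineQueue.coinversions (MultilineQueue.type (MultilineQueue.collapse M)) :=
  ⟨fun _ _ hij h => MultilineQueue.type_collapse_lt hM.descending hij h,
    fun _ hp => ⟨hp.1, MultilineQueue.type_collapse_lt hM.descending hp.1 hp.2⟩⟩
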